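/- Let $A,B\in\mathbb C^{n\times n}$ be Hermitian with $B=C^*C$, $C$ invertible. Let $X\in\mathbb C^{n\times n}$ and $\Lambda=\mathrm{diag}(\lambda_1,\dots,\lambda_n)$ (real, in any fixed numbering) satisfy $X^*BX=I$ and $AX=BX\Lambda$. Let $m\le p\le n$; let $X_m$ and $X_{m'}$ consist of the first $m$ and the last $n-m$ columns of $X$, and let $\Lambda_m=\mathrm{diag}(\lambda_1,\dots,\lambda_m)$, $\Lambda_{m'}=\mathrm{diag}(\lambda_{m+1},\dots,\lambda_n)$. All norms are $2$-norms. Let $\rho:\mathbb R\to\mathbb R$ be a function (in Algorithm FEAST, a quadrature approximation of the indicator function of the search interval), let $M=B^{-1}A$ and $\rho(M)=X\rho(\Lambda)X^*B$. Consider a run of the accelerated subspace iteration (Algorithm FEAST) with inexact application of $\rho(M)$: starting from $Q_0\in\mathbb C^{n\times p}$, for $k=1,2,\dots$, with arbitrary errors $\Delta_{k-1}\in\mathbb C^{n\times p}$, $Y_k=\rho(M)Q_{k-1}+\Delta_{k-1}$; the reduced problem $(Y_k^*AY_k)\widehat X_k=(Y_k^*BY_k)\widehat X_k\widehat\Lambda_k$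 is solved with $\widehat\Lambda_k=\mathrm{diag}(\widehat\lambda^{(k)}_1,\dots,\widehat\lambda^{(k)}_p)$ real; and $Q_k=Y_k\widehat X_k$ satisfies $Q_k^*BQ_k=I_p$. **Theorem.** Fix an iteration $k\ge1$ and suppose that $$Q_k=[\,(X_m+X_{m'}G_k)L_k^{-1},\ V_k\,]\,U_k ,$$ where $U_k$ is a $p\times p$ unitary matrix, $L_k^*L_k=(X_m+X_{m'}G_k)^*B(X_m+X_{m'}G_k)$ (for instance, $L_k$ is the Hermitian positive definite square root), and $\epsilon_k:=\|G_k\|\le 1/2$. Then $V_k$ can be written as $V_k=X_mS_k+X_{m'}H_kR_k$, with $H_k\in\mathbb C^{(n-m)\times(p-m)}$, $H_k^*H_k=I_{p-m}$, $\|S_k\|\le\epsilon_k$ and $\|R_k-I_{p-m}\|\le\epsilon_k^2$. Moreover, for every representation $V_k=X_mS_k+X_{m'}H_kR_k$ with $H_k^*H_k=I_{p-m}$ the following holds. Put $$\eta_k=\min\{|\lambda-\mu| : \lambda\in\mathrm{eig}(\Lambda_m),\ \mu\in\mathrm{eig}(H_k^*\Lambda_{m'}H_k)\}/\|\Lambda\|\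 \text{ if } m<p,\qquad \eta_k=\infty\ \text{ if } m=p .$$ Then there are $m$ distinct indices $\sigma(1),\dots,\sigma(m)\in\{1,\dots,p\}$ such that, with $\widehat\lambda_j$ the $\sigma(j)$-th diagonal entry of $\widehat\Lambda_k$ and $q_j$ the $\sigma(j)$-th column of $Q_k$, for every $j=1,\dots,m$, $$|\lambda_j-\widehat\lambda_j|\le 4\|\Lambda\|\bigl(\epsilon_k^2+\min\{\epsilon_k,\,4\epsilon_k^2/\eta_k\}\bigr)$$ and, if $\eta_k>0$, $$\|Aq_j-\widehat\lambda_jBq_j\|\le 12\,\|C\|\,\|\Lambda\|\,\epsilon_k\,(1+1/\eta_k).$$ Here $1/\infty=0$, and for $\eta_k=0$ the minimum in the first bound is $\epsilon_k$. -/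

import Mathlib

open scoped Matrix Matrix.Norms.L2Operator ENNReal

noncomputable section

namespace Feast

/-- The splitting of `{0, …, N-1}` into its first `m` and its last `N - m` elements. -/
def split {m N : ℕ} (h : m ≤ N) : Fin m ⊕ Fin (N - m) ≃ Fin N :=
  finSumFinEquiv.trans (finCongr (Nat.add_sub_cancel' h))

/-- The first `m` columns of a matrix. -/
def headCols {m N n : ℕ} (h : m ≤ N) (X : Matrix (Fin n) (Fin N) ℂ) :
    Matrix (Fin n) (Fin m) ℂ :=
  X.submatrix id fun i => split h (Sum.inl i)

/-- The columns of a matrix that follow the first `m` ones. -/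
def tailCols {m N n : ℕ} (h : m ≤ N) (X : Matrix (Fin n) (Fin N) ℂ) :
    Matrix (Fin n) (Fin (N - m)) ℂ :=
  X.submatrix id fun i => split h (Sum.inr i)

/-- The matrix `[P  V]` with `N` columns: first the `m` columns of `P`, then those of `V`. -/
def hcat {m N n : ℕ} (h : m ≤ N) (P : Matrix (Fin n) (Fin m) ℂ)
    (V : Matrix (Fin n) (Fin (N - m)) ℂ) : Matrix (Fin n) (Fin N) ℂ :=
  (Matrix.fromCols P V).submatrix id (split h).symm

/-- The real diagonal matrix `diag(d)`, as a complex matrix. -/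
def rdiag {ι : Type*} [DecidableEq ι] (d : ι → ℝ) : Matrix ι ι ℂ :=
  Matrix.diagonal fun i => (d i : ℂ)

/-- `Λ_m = diag(λ_1, …, λ_m)`, as the family of its diagonal entries. -/
def headVals {m n : ℕ} (h : m ≤ n) (lam : Fin n → ℝ) : Fin m → ℝ :=
  fun i => lam (split h (Sum.inl i))

/-- `Λ_{m'} = diag(λ_{m+1}, …, λ_n)`, as the family of its diagonal entries. -/
def tailVals {m n : ℕ} (h : m ≤ n) (lam : Fin n → ℝ) : Fin (n - m) → ℝ :=
  fun i => lam (split h (Sum.inr i))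

/-- The accelerator `ρ(M) = X ρ(Λ) X* B` where `M = B⁻¹ A = X Λ X* B`. -/
def accel {n : ℕ} (B X : Matrix (Fin n) (Fin n) ℂ) (lam : Fin n → ℝ) (ρ : ℝ → ℝ) :
    Matrix (Fin n) (Fin n) ℂ :=
  X * rdiag (fun i => ρ (lam i)) * Xᴴ * B

/-- One iteration of the accelerated subspace iteration with Rayleigh-Ritz projection, leading
from `Q₀` to `Q`, where `F` is the accelerator and `Δ` the error made in applying it. -/
structure IsIteration {n p : ℕ} (A B F : Matrix (Fin n) (Fin n) ℂ)
    (Q₀ Δ Y : Matrix (Fin n) (Fin p) ℂ) (Xhat : Matrix (Fin p) (Fin p) ℂ) (lamhat : Fin p → ℝ)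
    (Q : Matrix (Fin n) (Fin p) ℂ) : Prop where
  /-- approximate subspace projection -/
  projection : Y = F * Q₀ + Δ
  /-- the reduced eigenproblem `Â X̂ = B̂ X̂ Λ̂` with `Â = Y* A Y` and `B̂ = Y* B Y` -/
  reduced : (Yᴴ * A * Y) * Xhat = (Yᴴ * B * Y) * Xhat * rdiag lamhat
  /-- the new basis -/
  update : Q = Y * Xhat
  /-- the new basis is `B`-orthonormal -/
  orthonormal : Qᴴ * B * Q = 1

/-- A run of Algorithm FEAST with accelerator `F = ρ(M)`, from the initial `Q 0`; the
Gauss-Legendre quadrature approximation of the spectral projector is one choice of `ρ`. -/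
def IsRun {n p : ℕ} (A B F : Matrix (Fin n) (Fin n) ℂ)
    (Q Δ Y : ℕ → Matrix (Fin n) (Fin p) ℂ) (Xhat : ℕ → Matrix (Fin p) (Fin p) ℂ)
    (lamhat : ℕ → Fin p → ℝ) : Prop :=
  ∀ k, IsIteration A B F (Q k) (Δ k) (Y (k + 1)) (Xhat (k + 1)) (lamhat (k + 1)) (Q (k + 1))

/-- The relative gap `min |λ - μ| / ‖Λ‖` over the eigenvalues `λ` of `Λ_m` and `μ` of
`H* Λ_{m'} H` if `m < p`, and `∞` if `m = p`. -/
def gap {n m p : ℕ} (hmn : m ≤ n) (lam : Fin n → ℝ)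
    (H : Matrix (Fin (n - m)) (Fin (p - m)) ℂ) : ℝ≥0∞ :=
  if m < p then
    (⨅ i : Fin m, ⨅ μ ∈ spectrum ℝ (Hᴴ * rdiag (tailVals hmn lam) * H),
      ENNReal.ofReal |headVals hmn lam i - μ|) / ‖rdiag lam‖ₑ
  else ⊤

end Feast

end

noncomputable section

/-! In the coordinates given by the columns of `X`, the pencil becomes `diag(λ)` with the Euclidean
inner product, and `Q k = X Z U` with `Z = [L⁻¹ S; G L⁻¹ H R]`. Rayleigh-Ritz makes `Q* B Q = 1` and
`Q* A Q` diagonal, so `Z* Z = 1` and the Ritz values are the eigenvalues of `Z* diag(λ) Z`.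
Orthogonality of the two block columns of `Z` forces `S = -G* H R`, hence `‖S‖ ≤ ε`; the first claim
is then the polar decomposition of the lower right block.

For the estimates, a unitary change of basis (`exists_isReduced`) turns `L⁻¹` into `(1 + G*
G)^(-1/2)` and `R` into a unitary conjugate of `(1 - S* S)^(1/2)`, both within `ε²` of the identity,
and `H* Λ_{m'} H` into `diag(μ)`. With `ℓ = ‖Λ‖`, the compression then differs from `diag(Λ_m, μ)`
by diagonal blocks of norm at most `3 ε² ℓ` and off-diagonal blocks of norm at most `2 ε ℓ`.

Diagonal errors act as in Weyl's inequality. A coupling `e` costs only `τ` with `e² ≤ τ (δ + τ)`,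
where `δ` is the distance from `Λ_m` to `μ`: `τ = e` always works, and `τ = e² / δ` works across a
gap. This follows by counting eigenvalues above and below `λ_j ∓ (c + τ)` and pairing the sorted
lists (`exists_eigenvalue_matching`).

For the residual, the second row of the eigenvector equation bounds the `μ`-component `y` by a
multiple of `ε ℓ / δ`, and the first row controls `(Λ_m - t) x` (`IsReduced.vnorm_residual_le`). The
factor `‖C‖` comes from returning to the original coordinates. -/

namespace Feast

set_option linter.unusedSectionVars false

/-! ### Euclidean norms, eigenvalue counting and sorted matching. -/

section VectorNorms

open Matrix Finset

variable {ι κ : Type*} [Fintype ι] [DecidableEq ι] [Fintype κ] [DecidableEq κ]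

/-- The Euclidean norm of a coordinate vector. -/
def vnorm (v : ι → ℂ) : ℝ := ‖WithLp.toLp 2 v‖

theorem vnorm_nonneg (v : ι → ℂ) : 0 ≤ vnorm v := norm_nonneg _

theorem vnorm_sq (v : ι → ℂ) : vnorm v ^ 2 = ∑ i, ‖v i‖ ^ 2 := by
  simp [vnorm, EuclideanSpace.norm_sq_eq]

theorem vnorm_add_le (v w : ι → ℂ) : vnorm (v + w) ≤ vnorm v + vnorm w := by
  simpa [vnorm] using norm_add_le (WithLp.toLp 2 v) (WithLp.toLp 2 w)

theorem vnorm_neg (v : ι → ℂ) : vnorm (-v) = vnorm v := by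
  simp [vnorm]

theorem vnorm_mulVec_le (M : Matrix ι κ ℂ) (v : κ → ℂ) : vnorm (M *ᵥ v) ≤ ‖M‖ * vnorm v :=
  l2_opNorm_mulVec M (WithLp.toLp 2 v)

theorem norm_star_dotProduct_le (v w : ι → ℂ) : ‖star v ⬝ᵥ w‖ ≤ vnorm v * vnorm w := by
  have := norm_inner_le_norm (𝕜 := ℂ) (WithLp.toLp 2 v) (WithLp.toLp 2 w)
  rwa [EuclideanSpace.inner_toLp_toLp, dotProduct_comm] at this

theorem star_dotProduct_self (v : ι → ℂ) : star v ⬝ᵥ v = ((vnorm v ^ 2 : ℝ) : ℂ) := by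
  rw [vnorm_sq]
  simp [dotProduct, ← Complex.normSq_eq_norm_sq, Complex.normSq_eq_conj_mul_self]

theorem norm_form_le (M : Matrix ι κ ℂ) (v : ι → ℂ) (w : κ → ℂ) :
    ‖star v ⬝ᵥ (M *ᵥ w)‖ ≤ ‖M‖ * vnorm v * vnorm w := by
  refine (norm_star_dotProduct_le _ _).trans ?_
  nlinarith [vnorm_mulVec_le M w, vnorm_nonneg v]

theorem norm_le_of_vnorm_mulVec_le (M : Matrix ι κ ℂ) {c : ℝ} (hc : 0 ≤ c)
    (h : ∀ v, vnorm (M *ᵥ v) ≤ c * vnorm v) : ‖M‖ ≤ c := by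
  rw [l2_opNorm_def]
  exact ContinuousLinearMap.opNorm_le_bound _ hc fun x => h x.ofLp

theorem vnorm_mulVec_sq (M : Matrix ι κ ℂ) (v : κ → ℂ) :
    ((vnorm (M *ᵥ v) ^ 2 : ℝ) : ℂ) = star v ⬝ᵥ ((Mᴴ * M) *ᵥ v) := by
  rw [← star_dotProduct_self, star_mulVec, ← mulVec_mulVec, dotProduct_mulVec,
    dotProduct_mulVec, dotProduct_mulVec]

theorem vnorm_mulVec_isometry {M : Matrix ι κ ℂ} (hM : Mᴴ * M = 1) (v : κ → ℂ) :
    vnorm (M *ᵥ v) = vnorm v := by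
  have h := vnorm_mulVec_sq M v
  rw [hM, one_mulVec, star_dotProduct_self] at h
  have h' : vnorm (M *ᵥ v) ^ 2 = vnorm v ^ 2 := by exact_mod_cast h
  exact (sq_eq_sq₀ (vnorm_nonneg _) (vnorm_nonneg _)).1 h'

theorem norm_le_one_of_isometry {M : Matrix ι κ ℂ} (hM : Mᴴ * M = 1) : ‖M‖ ≤ 1 :=
  norm_le_of_vnorm_mulVec_le M zero_le_one fun v => by rw [vnorm_mulVec_isometry hM, one_mul]

theorem norm_rdiag_le {d : ι → ℝ} {c : ℝ} (hc : 0 ≤ c) (h : ∀ i, |d i| ≤ c) :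
    ‖rdiag d‖ ≤ c := by
  rw [rdiag, l2_opNorm_diagonal, pi_norm_le_iff_of_nonneg hc]
  intro i
  simpa using h i

theorem abs_le_norm_rdiag (d : ι → ℝ) (i : ι) : |d i| ≤ ‖rdiag d‖ := by
  rw [rdiag, l2_opNorm_diagonal]
  simpa using norm_le_pi_norm (fun i => (d i : ℂ)) i

theorem form_rdiag (d : ι → ℝ) (v : ι → ℂ) :
    star v ⬝ᵥ (rdiag d *ᵥ v) = ((∑ i, d i * ‖v i‖ ^ 2 : ℝ) : ℂ) := by
  simp only [rdiag, mulVec_diagonal, dotProduct]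
  push_cast
  refine Finset.sum_congr rfl fun i _ => ?_
  have : star (v i) * v i = ((‖v i‖ ^ 2 : ℝ) : ℂ) := by
    rw [← Complex.normSq_eq_norm_sq, Complex.normSq_eq_conj_mul_self]; rfl
  push_cast at this
  rw [← this, Pi.star_apply]
  ring

/-- If the Hermitian form with eigenvalues `α` is at least `s` on the span of the coordinate
vectors of `S`, then at least `#S` of its eigenvalues are at least `s`. -/
theorem card_le_card_eigenvalues_ge (U : Matrix ι κ ℂ) (hU : U * Uᴴ = 1) (α : κ → ℝ)
    (S : Finset ι) (s : ℝ)
    (h : ∀ u : ι → ℂ, (∀ i ∉ S, u i = 0) →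
      s * vnorm u ^ 2 ≤ (star u ⬝ᵥ ((U * rdiag α * Uᴴ) *ᵥ u)).re) :
    S.card ≤ (univ.filter fun r => s ≤ α r).card := by
  by_contra! hlt
  let extZero : (S → ℂ) →ₗ[ℂ] (ι → ℂ) :=
    { toFun := fun w i => if hi : i ∈ S then w ⟨i, hi⟩ else 0
      map_add' := fun a b => by ext i; by_cases hi : i ∈ S <;> simp [hi]
      map_smul' := fun c a => by ext i; by_cases hi : i ∈ S <;> simp [hi] }
  let f : (S → ℂ) →ₗ[ℂ] ((univ.filter fun r => s ≤ α r : Finset κ) → ℂ) :=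
    (LinearMap.funLeft ℂ ℂ Subtype.val).comp ((Matrix.mulVecLin Uᴴ).comp extZero)
  -- Dimension count: some nonzero vector supported on `S` is orthogonal to every eigenvector with
  -- eigenvalue at least `s`, so its form should fall strictly below `s`.
  have hker : LinearMap.ker f ≠ ⊥ := f.ker_ne_bot_of_finrank_lt (by
    rw [Module.finrank_fintype_fun_eq_card, Module.finrank_fintype_fun_eq_card,
      Fintype.card_coe, Fintype.card_coe]
    exact hlt)
  obtain ⟨w, hw, hw0⟩ := (Submodule.ne_bot_iff _).1 hker
  set u := extZero w with hu
  have hu0 : u ≠ 0 := by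
    intro h0
    apply hw0
    ext i
    have := congrFun h0 i
    simpa [hu, extZero] using this
  have hform := h u fun i hi => by simp [hu, extZero, hi]
  set t := Uᴴ *ᵥ u with ht
  have htn : vnorm t = vnorm u := vnorm_mulVec_isometry (by simpa using hU) u
  have hz : ∀ r, s ≤ α r → t r = 0 := fun r hr => by
    have := congrFun (LinearMap.mem_ker.1 hw) ⟨r, by simpa using hr⟩
    simpa [f] using this
  have e1 : star u ⬝ᵥ ((U * rdiag α * Uᴴ) *ᵥ u) = star t ⬝ᵥ (rdiag α *ᵥ t) := by
    rw [ht, star_mulVec, conjTranspose_conjTranspose, ← mulVec_mulVec, ← mulVec_mulVec,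
      dotProduct_mulVec]
  rw [e1, form_rdiag, Complex.ofReal_re, ← htn, vnorm_sq, Finset.mul_sum] at hform
  have hle : ∀ r ∈ univ, α r * ‖t r‖ ^ 2 ≤ s * ‖t r‖ ^ 2 := fun r _ => by
    rcases le_or_gt s (α r) with hr | hr
    · simp [hz r hr]
    · gcongr
  have heq := (Finset.sum_eq_sum_iff_of_le hle).1 (le_antisymm (Finset.sum_le_sum hle) hform)
  have ht0 : t = 0 := by
    ext r
    rcases le_or_gt s (α r) with hr | hr
    · exact hz r hr
    · have := heq r (mem_univ r)
      by_contra hne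
      have hp : 0 < ‖t r‖ ^ 2 := by positivity
      nlinarith
  apply hu0
  have : U *ᵥ t = u := by rw [ht, mulVec_mulVec, hU, one_mulVec]
  rw [← this, ht0, mulVec_zero]

/-- Two real families of the same size can be matched in increasing order, so that counting
estimates give estimates of the differences. -/
theorem exists_sorted_matching {N : ℕ} (α : Fin N → ℝ) (β : ι → ℝ) (hN : Fintype.card ι = N) :
    ∃ e : ι ≃ Fin N, ∀ (i : ι) (c : ℝ),
      (univ.filter fun l => β i ≤ β l).card ≤ (univ.filter fun r => β i - c ≤ α r).card →
      (univ.filter fun l => β l ≤ β i).card ≤ (univ.filter fun r => α r ≤ β i + c).card →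
      |β i - α (e i)| ≤ c := by
  let e₀ : ι ≃ Fin N := Fintype.equivFinOfCardEq hN
  let b : Fin N → ℝ := β ∘ e₀.symm
  let sb := Tuple.sort b
  let sa := Tuple.sort α
  have hb : Monotone (b ∘ sb) := Tuple.monotone_sort b
  have ha : Monotone (α ∘ sa) := Tuple.monotone_sort α
  -- The matching is fixed before `i` and `c` are given, so a single bijection serves all indices
  -- and all error bounds.
  refine ⟨e₀.trans (sb.symm.trans sa), fun i c h1 h2 => ?_⟩
  set j : Fin N := sb.symm (e₀ i) with hj
  have hbj : b (sb j) = β i := by simp [b, hj]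
  have cb (P : ℝ → Prop) [DecidablePred P] : (univ.filter fun l => P (β l)).card =
      (univ.filter fun r => P (b (sb r))).card := by
    refine Finset.card_equiv (e₀.trans sb.symm) fun l => ?_
    simp [b]
  have ca (P : ℝ → Prop) [DecidablePred P] : (univ.filter fun l => P (α l)).card =
      (univ.filter fun r => P (α (sa r))).card := by
    refine Finset.card_equiv sa.symm fun l => ?_
    simp
  rw [cb (fun x => β i ≤ x), ca (fun x => β i - c ≤ x)] at h1
  rw [cb (fun x => x ≤ β i), ca (fun x => x ≤ β i + c)] at h2
  show |β i - α (sa j)| ≤ c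
  rw [abs_le]
  constructor
  · by_contra! hc
    -- If the partner of `β i` exceeded `β i + c`, at most `j` values of `α` would lie below that
    -- level, while at least `j + 1` values of `β` are at most `β i`.
    have l1 : (univ.filter fun r => α (sa r) ≤ β i + c).card ≤ (Finset.Iio j).card := by
      refine Finset.card_le_card fun r hr => ?_
      simp only [mem_filter, mem_univ, true_and] at hr
      rw [Finset.mem_Iio]
      by_contra! hjr
      have := ha hjr
      simp only [Function.comp] at this
      linarith
    have l2 : (Finset.Iic j).card ≤ (univ.filter fun r => b (sb r) ≤ β i).card := by
      refine Finset.card_le_card fun r hr => ?_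
      rw [Finset.mem_Iic] at hr
      simp only [mem_filter, mem_univ, true_and]
      rw [← hbj]
      exact hb hr
    simp only [Fin.card_Iio, Fin.card_Iic] at l1 l2
    omega
  · by_contra! hc
    have l1 : (univ.filter fun r => β i - c ≤ α (sa r)).card ≤ (Finset.Ioi j).card := by
      refine Finset.card_le_card fun r hr => ?_
      simp only [mem_filter, mem_univ, true_and] at hr
      rw [Finset.mem_Ioi]
      by_contra! hjr
      have := ha hjr
      simp only [Function.comp] at this
      linarith
    have l2 : (Finset.Ici j).card ≤ (univ.filter fun r => β i ≤ b (sb r)).card := by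
      refine Finset.card_le_card fun r hr => ?_
      rw [Finset.mem_Ici] at hr
      simp only [mem_filter, mem_univ, true_and]
      rw [← hbj]
      exact hb hr
    simp only [Fin.card_Ioi, Fin.card_Ici] at l1 l2
    have := j.2
    omega

end VectorNorms

/-! ### Perturbation of block diagonal Hermitian forms; square roots of Gram matrices. -/

section Perturbation

open Matrix Finset

variable {ι κ : Type*} [Fintype ι] [DecidableEq ι] [Fintype κ] [DecidableEq κ]

theorem vnorm_sum_sq (u : ι ⊕ κ → ℂ) :
    vnorm u ^ 2 = vnorm (u ∘ Sum.inl) ^ 2 + vnorm (u ∘ Sum.inr) ^ 2 := by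
  simp [vnorm_sq]

/-- Weighted AM-GM. With `a = τ` and `b = δ + τ` it absorbs the coupling term, the gap paying for
the larger weight on the second block. -/
theorem two_mul_le_of_sq_le_mul {a b e x y : ℝ} (ha : 0 ≤ a) (hb : 0 ≤ b) (hx : 0 ≤ x)
    (hy : 0 ≤ y) (h : e ^ 2 ≤ a * b) : 2 * e * x * y ≤ a * x ^ 2 + b * y ^ 2 := by
  have h1 : e ≤ √a * √b := by
    rw [← Real.sqrt_mul ha]
    exact Real.le_sqrt_of_sq_le h
  have h2 : e * (x * y) ≤ √a * √b * (x * y) := mul_le_mul_of_nonneg_right h1 (by positivity)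
  have h3 := sq_nonneg (√a * x - √b * y)
  have h4 := Real.sq_sqrt ha
  have h5 := Real.sq_sqrt hb
  nlinarith

/-- A coupling of size `e` between two spectra separated by `δ` displaces the eigenvalues
downwards by at most `τ`, where `e ^ 2 ≤ τ * (δ + τ)`. -/
theorem form_lower_bound {lam : ι → ℝ} {μ : κ → ℝ} {f : (ι ⊕ κ → ℂ) → ℝ} {c e τ δ t : ℝ}
    (hf : ∀ u, (∑ i, lam i * ‖u (.inl i)‖ ^ 2) + (∑ l, μ l * ‖u (.inr l)‖ ^ 2)
      - (c * vnorm u ^ 2 + 2 * e * vnorm (u ∘ Sum.inl) * vnorm (u ∘ Sum.inr)) ≤ f u)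
    (hτ : 0 ≤ τ) (hδ : 0 ≤ δ) (he : e ^ 2 ≤ τ * (δ + τ)) (hgap : ∀ l, δ ≤ |t - μ l|)
    (u : ι ⊕ κ → ℂ) (hu : ∀ i, ¬ t ≤ Sum.elim lam μ i → u i = 0) :
    (t - (c + τ)) * vnorm u ^ 2 ≤ f u := by
  refine le_trans ?_ (hf u)
  have h1 : t * vnorm (u ∘ Sum.inl) ^ 2 ≤ ∑ i, lam i * ‖u (.inl i)‖ ^ 2 := by
    rw [vnorm_sq, mul_sum]
    refine sum_le_sum fun i _ => ?_
    by_cases hi : t ≤ lam i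
    · simp only [Function.comp]; gcongr
    · simp [hu (.inl i) hi]
  have h2 : (t + δ) * vnorm (u ∘ Sum.inr) ^ 2 ≤ ∑ l, μ l * ‖u (.inr l)‖ ^ 2 := by
    rw [vnorm_sq, mul_sum]
    refine sum_le_sum fun l _ => ?_
    -- The gap condition carries no sign; on the coordinates that survive, `t ≤ μ l`, so it yields
    -- `t + δ ≤ μ l`.
    by_cases hl : t ≤ μ l
    · have := hgap l
      rw [abs_sub_comm, abs_of_nonneg (by linarith)] at this
      simp only [Function.comp]
      gcongr
      linarith
    · simp [hu (.inr l) hl]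
  have h3 := two_mul_le_of_sq_le_mul hτ (add_nonneg hδ hτ) (vnorm_nonneg (u ∘ Sum.inl))
    (vnorm_nonneg (u ∘ Sum.inr)) he
  rw [vnorm_sum_sq]
  linarith

/-- Eigenvalues of a Hermitian matrix that is close to a block diagonal one: an error `c` in the
form and a coupling `e` of the blocks, whose spectra have distance at least `δ`. -/
theorem exists_eigenvalue_matching {N : ℕ} (hN : Fintype.card (ι ⊕ κ) = N)
    (U : Matrix (ι ⊕ κ) (Fin N) ℂ) (hU : U * Uᴴ = 1) (α : Fin N → ℝ)
    (lam : ι → ℝ) (μ : κ → ℝ) {c e τ δ : ℝ}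
    (hform : ∀ u : ι ⊕ κ → ℂ, |(star u ⬝ᵥ ((U * rdiag α * Uᴴ) *ᵥ u)).re -
      ((∑ i, lam i * ‖u (.inl i)‖ ^ 2) + (∑ l, μ l * ‖u (.inr l)‖ ^ 2))| ≤
      c * vnorm u ^ 2 + 2 * e * vnorm (u ∘ Sum.inl) * vnorm (u ∘ Sum.inr))
    (hτ : 0 ≤ τ) (hδ : 0 ≤ δ) (he : e ^ 2 ≤ τ * (δ + τ)) (hgap : ∀ j l, δ ≤ |lam j - μ l|) :
    ∃ σ : ι ↪ Fin N, ∀ j, |lam j - α (σ j)| ≤ c + τ := by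
  obtain ⟨eq, heq⟩ := exists_sorted_matching α (Sum.elim lam μ) hN
  refine ⟨Function.Embedding.inl.trans eq.toEmbedding, fun j => ?_⟩
  refine heq (.inl j) (c + τ) ?_ ?_
  · refine card_le_card_eigenvalues_ge U hU α _ _ fun u hu => ?_
    refine form_lower_bound (lam := lam) (μ := μ)
      (f := fun u => (star u ⬝ᵥ ((U * rdiag α * Uᴴ) *ᵥ u)).re)
      (fun v => ?_) hτ hδ he (hgap j) u fun i hi => hu i fun h => hi (mem_filter.1 h).2
    have := (abs_le.1 (hform v)).1
    linarith
  -- The upper count is the lower count for the negated form, whose gap is the same.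
  · have key := card_le_card_eigenvalues_ge U hU (fun r => - α r)
      (univ.filter fun l => Sum.elim lam μ l ≤ Sum.elim lam μ (.inl j)) (-(lam j) - (c + τ))
      fun u hu => ?_
    · refine key.trans (Finset.card_le_card fun r hr => ?_)
      have h := (mem_filter.1 hr).2
      refine mem_filter.2 ⟨mem_univ r, ?_⟩
      rw [Sum.elim_inl]
      linarith
    · refine form_lower_bound (lam := fun i => - lam i) (μ := fun l => - μ l)
        (f := fun u => (star u ⬝ᵥ ((U * rdiag (fun r => - α r) * Uᴴ) *ᵥ u)).re)
        (fun v => ?_) hτ hδ he (fun l => ?_) u fun i hi => hu i ?_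
      · have hneg : U * rdiag (fun r => - α r) * Uᴴ = -(U * rdiag α * Uᴴ) := by
          have : rdiag (fun r => - α r) = - rdiag α := by
            simp [rdiag, ← Matrix.diagonal_neg]
          rw [this]; simp
        have := (abs_le.1 (hform v)).2
        simp only [hneg, neg_mulVec, dotProduct_neg, Complex.neg_re, neg_mul, sum_neg_distrib]
        linarith
      · rw [show -lam j - -μ l = -(lam j - μ l) by ring, abs_neg]
        exact hgap j l
      · intro h
        simp only [mem_filter, mem_univ, true_and] at h
        apply hi
        rcases i with i | i <;> simpa using h

theorem rdiag_mul_rdiag (a b : ι → ℝ) : rdiag a * rdiag b = rdiag fun i => a i * b i := by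
  simp [rdiag]

theorem rdiag_conjTranspose (a : ι → ℝ) : (rdiag a)ᴴ = rdiag a := by
  rw [rdiag, diagonal_conjTranspose]
  congr 1
  ext i
  simp

/-- Unitary diagonalization of a Hermitian matrix. -/
theorem exists_diagonalization {M : Matrix ι ι ℂ} (hM : M.IsHermitian) :
    ∃ (F : Matrix ι ι ℂ) (μ : ι → ℝ), Fᴴ * F = 1 ∧ F * Fᴴ = 1 ∧ M = F * rdiag μ * Fᴴ ∧
      ∀ i, μ i ∈ spectrum ℝ M := by
  refine ⟨hM.eigenvectorUnitary, hM.eigenvalues, ?_, ?_, ?_, hM.eigenvalues_mem_spectrum_real⟩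
  · exact Unitary.coe_star_mul_self hM.eigenvectorUnitary
  · exact Unitary.coe_mul_star_self hM.eigenvectorUnitary
  · conv_lhs => rw [hM.spectral_theorem]
    rfl

theorem norm_conj_unitary_le {F : Matrix ι ι ℂ} (hF : Fᴴ * F = 1) (M : Matrix ι ι ℂ) :
    ‖F * M * Fᴴ‖ ≤ ‖M‖ := by
  have h1 := norm_le_one_of_isometry hF
  have h2 : ‖Fᴴ‖ ≤ 1 := by rwa [l2_opNorm_conjTranspose]
  calc ‖F * M * Fᴴ‖ ≤ ‖F * M‖ * ‖Fᴴ‖ := l2_opNorm_mul _ _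
    _ ≤ (‖F‖ * ‖M‖) * ‖Fᴴ‖ := by gcongr; exact l2_opNorm_mul _ _
    _ ≤ (1 * ‖M‖) * 1 := by gcongr
    _ = ‖M‖ := by ring

/-- Diagonalization of `Gᴴ * G`, whose eigenvalues lie between `0` and `‖G‖ ^ 2`. -/
theorem exists_diagonalization_gram (G : Matrix κ ι ℂ) :
    ∃ (F : Matrix ι ι ℂ) (μ : ι → ℝ), Fᴴ * F = 1 ∧ F * Fᴴ = 1 ∧ Gᴴ * G = F * rdiag μ * Fᴴ ∧
      (∀ i, 0 ≤ μ i) ∧ ∀ i, μ i ≤ ‖G‖ ^ 2 := by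
  obtain ⟨F, μ, h1, h2, h3, -⟩ := exists_diagonalization (isHermitian_conjTranspose_mul_self G)
  have hμ : rdiag μ = (G * F)ᴴ * (G * F) := by
    calc rdiag μ = (Fᴴ * F) * rdiag μ * (Fᴴ * F) := by rw [h1, Matrix.one_mul, Matrix.mul_one]
      _ = Fᴴ * (F * rdiag μ * Fᴴ) * F := by simp only [Matrix.mul_assoc]
      _ = _ := by rw [← h3, conjTranspose_mul]; simp only [Matrix.mul_assoc]
  refine ⟨F, μ, h1, h2, h3, fun i => ?_, fun i => ?_⟩
  · have := vnorm_mulVec_sq (G * F) (Pi.single i 1)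
    rw [← hμ, form_rdiag] at this
    have h' : vnorm ((G * F) *ᵥ Pi.single i 1) ^ 2 = _ := Complex.ofReal_injective this
    rw [Finset.sum_eq_single i (fun b _ hb => by simp [hb]) (by simp)] at h'
    simp only [Pi.single_eq_same, norm_one, one_pow, mul_one] at h'
    rw [← h']
    positivity
  -- Since `diag(μ) = (G F)* (G F)`, its norm is `‖G F‖ ^ 2`.
  · refine (le_abs_self _).trans ((abs_le_norm_rdiag μ i).trans ?_)
    rw [hμ, l2_opNorm_conjTranspose_mul_self]
    have := l2_opNorm_mul G F
    have hF := norm_le_one_of_isometry h1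
    have : ‖G * F‖ ≤ ‖G‖ := by nlinarith [norm_nonneg G]
    nlinarith [norm_nonneg (G * F)]

/-- The inverse square root of `1 + Gᴴ * G`. -/
theorem exists_inv_sqrt_one_add_gram (G : Matrix κ ι ℂ) :
    ∃ D : Matrix ι ι ℂ, Dᴴ = D ∧ D * (1 + Gᴴ * G) * D = 1 ∧ ‖D‖ ≤ 1 ∧ ‖D - 1‖ ≤ ‖G‖ ^ 2 := by
  obtain ⟨F, μ, h1, h2, h3, h0, hle⟩ := exists_diagonalization_gram G
  have hs (i) : 1 ≤ √(1 + μ i) := by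
    rw [Real.one_le_sqrt]; linarith [h0 i]
  have hinv (i) : (√(1 + μ i))⁻¹ ≤ 1 := inv_le_one_of_one_le₀ (hs i)
  refine ⟨F * rdiag (fun i => (√(1 + μ i))⁻¹) * Fᴴ, ?_, ?_, ?_, ?_⟩
  · simp [conjTranspose_mul, rdiag_conjTranspose, Matrix.mul_assoc]
  · have e1 : 1 + Gᴴ * G = F * rdiag (fun i => 1 + μ i) * Fᴴ := by
      have : rdiag (fun i => 1 + μ i) = 1 + rdiag μ := by
        simp [rdiag, ← diagonal_one, diagonal_add]
      rw [this, h3, Matrix.mul_add, Matrix.add_mul, Matrix.mul_one, h2]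
    rw [e1]
    calc _ = F * (rdiag (fun i => (√(1 + μ i))⁻¹) * (Fᴴ * F) * rdiag (fun i => 1 + μ i) *
          (Fᴴ * F) * rdiag (fun i => (√(1 + μ i))⁻¹)) * Fᴴ := by simp only [Matrix.mul_assoc]
      _ = 1 := by
        rw [h1, Matrix.mul_one, Matrix.mul_one, rdiag_mul_rdiag, rdiag_mul_rdiag]
        have : rdiag (fun i => (√(1 + μ i))⁻¹ * (1 + μ i) * (√(1 + μ i))⁻¹) = 1 := by
          rw [rdiag, ← diagonal_one]
          congr 1
          ext i
          have := hs i
          have hq := Real.sq_sqrt (show 0 ≤ 1 + μ i by linarith [h0 i])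
          have : (√(1 + μ i))⁻¹ * (1 + μ i) * (√(1 + μ i))⁻¹ = 1 := by
            field_simp
            linarith
          rw [this]; simp
        rw [this, Matrix.mul_one, h2]
  · refine (norm_conj_unitary_le h1 _).trans (norm_rdiag_le zero_le_one fun i => ?_)
    rw [abs_of_nonneg (by positivity)]
    exact hinv i
  · have e1 : F * rdiag (fun i => (√(1 + μ i))⁻¹) * Fᴴ - 1 =
        F * rdiag (fun i => (√(1 + μ i))⁻¹ - 1) * Fᴴ := by
      have : rdiag (fun i => (√(1 + μ i))⁻¹ - 1) = rdiag (fun i => (√(1 + μ i))⁻¹) - 1 := by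
        simp [rdiag, ← diagonal_one, diagonal_sub]
      rw [this, Matrix.mul_sub, Matrix.sub_mul, Matrix.mul_one, h2]
    rw [e1]
    refine (norm_conj_unitary_le h1 _).trans (norm_rdiag_le (by positivity) fun i => ?_)
    rw [abs_sub_comm, abs_of_nonneg (by linarith [hinv i])]
    refine le_trans ?_ (hle i)
    have hq := Real.sq_sqrt (show 0 ≤ 1 + μ i by linarith [h0 i])
    have h5 : (√(1 + μ i))⁻¹ * √(1 + μ i) = 1 := inv_mul_cancel₀ (by linarith [hs i])
    have h6 : 0 ≤ (√(1 + μ i))⁻¹ := by positivity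
    nlinarith [hs i, hinv i, h0 i]

/-- The square root of `1 - Sᴴ * S` for a strict contraction `S`, and its inverse. -/
theorem exists_sqrt_one_sub_gram (S : Matrix κ ι ℂ) (hS : ‖S‖ < 1) :
    ∃ R T : Matrix ι ι ℂ, Rᴴ = R ∧ Tᴴ = T ∧ R * R = 1 - Sᴴ * S ∧ R * T = 1 ∧ T * R = 1 ∧
      ‖R - 1‖ ≤ ‖S‖ ^ 2 ∧ ‖R‖ ≤ 1 := by
  obtain ⟨F, μ, h1, h2, h3, h0, hle⟩ := exists_diagonalization_gram S
  have hS2 : ‖S‖ ^ 2 < 1 := by nlinarith [norm_nonneg S]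
  have hp (i) : 0 < 1 - μ i := by linarith [hle i]
  have hs (i) : 0 < √(1 - μ i) := Real.sqrt_pos.2 (hp i)
  have hs1 (i) : √(1 - μ i) ≤ 1 := by rw [Real.sqrt_le_one]; linarith [h0 i]
  have hmul (a b : ι → ℝ) : (F * rdiag a * Fᴴ) * (F * rdiag b * Fᴴ) =
      F * rdiag (fun i => a i * b i) * Fᴴ := by
    rw [← rdiag_mul_rdiag]
    calc _ = F * (rdiag a * (Fᴴ * F) * rdiag b) * Fᴴ := by simp only [Matrix.mul_assoc]
      _ = _ := by rw [h1, Matrix.mul_one]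
  have hone {a : ι → ℝ} (ha : ∀ i, a i = 1) : F * rdiag a * Fᴴ = 1 := by
    have : rdiag a = 1 := by simp [rdiag, ha]
    rw [this, Matrix.mul_one, h2]
  have hsub (a : ι → ℝ) : F * rdiag (fun i => a i - 1) * Fᴴ = F * rdiag a * Fᴴ - 1 := by
    have : rdiag (fun i => a i - 1) = rdiag a - 1 := by
      simp [rdiag, ← diagonal_one, diagonal_sub]
    rw [this, Matrix.mul_sub, Matrix.sub_mul, Matrix.mul_one, h2]
  refine ⟨F * rdiag (fun i => √(1 - μ i)) * Fᴴ, F * rdiag (fun i => (√(1 - μ i))⁻¹) * Fᴴ,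
    ?_, ?_, ?_, ?_, ?_, ?_, ?_⟩
  · simp [conjTranspose_mul, rdiag_conjTranspose, Matrix.mul_assoc]
  · simp [conjTranspose_mul, rdiag_conjTranspose, Matrix.mul_assoc]
  · rw [hmul, h3]
    have : (fun i => √(1 - μ i) * √(1 - μ i)) = fun i => -(μ i - 1) := by
      ext i; rw [Real.mul_self_sqrt (hp i).le]; ring
    have h4 : rdiag (fun i => -(μ i - 1)) = - rdiag (fun i => μ i - 1) := by
      rw [rdiag, rdiag, diagonal_neg]; simp
    rw [this, h4, Matrix.mul_neg, Matrix.neg_mul, hsub]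
    abel
  · rw [hmul]; exact hone fun i => mul_inv_cancel₀ (hs i).ne'
  · rw [hmul]; exact hone fun i => inv_mul_cancel₀ (hs i).ne'
  · rw [← hsub]
    refine (norm_conj_unitary_le h1 _).trans (norm_rdiag_le (by positivity) fun i => ?_)
    rw [abs_sub_comm, abs_of_nonneg (by linarith [hs1 i])]
    have hq := Real.sq_sqrt (hp i).le
    nlinarith [hs i, hs1 i, hle i]
  · refine (norm_conj_unitary_le h1 _).trans (norm_rdiag_le zero_le_one fun i => ?_)
    rw [abs_of_nonneg (by positivity)]
    exact hs1 i

end Perturbation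

/-! ### Compression to a nearly block diagonal basis, and residuals. -/

section BlockBasis

open Matrix Finset

variable {ι κ ν : Type*} [Fintype ι] [DecidableEq ι] [Fintype κ] [DecidableEq κ]
  [Fintype ν] [DecidableEq ν]

theorem norm_matmul_le {P : Matrix ι κ ℂ} {Q : Matrix κ ν ℂ} {a b : ℝ} (hP : ‖P‖ ≤ a)
    (hQ : ‖Q‖ ≤ b) : ‖P * Q‖ ≤ a * b :=
  (l2_opNorm_mul P Q).trans
    (mul_le_mul hP hQ (norm_nonneg _) ((norm_nonneg _).trans hP))

theorem vnorm_mulVec_le_of_le {P : Matrix ι κ ℂ} {v : κ → ℂ} {a b : ℝ} (hP : ‖P‖ ≤ a)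
    (hv : vnorm v ≤ b) : vnorm (P *ᵥ v) ≤ a * b :=
  (vnorm_mulVec_le P v).trans
    (mul_le_mul hP hv (vnorm_nonneg _) ((norm_nonneg _).trans hP))

theorem norm_conjTranspose_le {P : Matrix ι κ ℂ} {a : ℝ} (hP : ‖P‖ ≤ a) : ‖Pᴴ‖ ≤ a := by
  rwa [l2_opNorm_conjTranspose]

/-- The matrix `[D S; G D, H R]`. -/
def blockBasis (D : Matrix ι ι ℂ) (G : Matrix ν ι ℂ) (S : Matrix ι κ ℂ) (H : Matrix ν κ ℂ)
    (R : Matrix κ κ ℂ) : Matrix (ι ⊕ ν) (ι ⊕ κ) ℂ :=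
  fromBlocks D S (G * D) (H * R)

/-- The block basis `[D S; G D, H R]` differs little from `[1 0; 0 H]`, and `H` diagonalizes the
compression of `diag(b)`. -/
structure IsReduced (a : ι → ℝ) (b : ν → ℝ) (μ : κ → ℝ) (ε ℓ : ℝ) (D : Matrix ι ι ℂ)
    (G : Matrix ν ι ℂ) (S : Matrix ι κ ℂ) (H : Matrix ν κ ℂ) (R : Matrix κ κ ℂ) : Prop where
  norm_a : ‖rdiag a‖ ≤ ℓ
  norm_b : ‖rdiag b‖ ≤ ℓ
  norm_G : ‖G‖ ≤ ε
  norm_S : ‖S‖ ≤ ε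
  herm_D : Dᴴ = D
  norm_D : ‖D‖ ≤ 1
  norm_D_sub : ‖D - 1‖ ≤ ε ^ 2
  isometry_H : Hᴴ * H = 1
  diag_H : Hᴴ * rdiag b * H = rdiag μ
  norm_R : ‖R‖ ≤ 1
  norm_R_sub : ‖R - 1‖ ≤ ε ^ 2

/-- The leading diagonal block of the compression of `diag(a, b)`. -/
def block₁₁ (a : ι → ℝ) (b : ν → ℝ) (D : Matrix ι ι ℂ) (G : Matrix ν ι ℂ) : Matrix ι ι ℂ :=
  D * rdiag a * D + D * Gᴴ * rdiag b * G * D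

/-- The off-diagonal block of the compression of `diag(a, b)`. -/
def block₁₂ (a : ι → ℝ) (b : ν → ℝ) (D : Matrix ι ι ℂ) (G : Matrix ν ι ℂ) (S : Matrix ι κ ℂ)
    (H : Matrix ν κ ℂ) (R : Matrix κ κ ℂ) : Matrix ι κ ℂ :=
  D * rdiag a * S + D * Gᴴ * rdiag b * H * R

/-- The trailing diagonal block of the compression of `diag(a, b)`. -/
def block₂₂ (a : ι → ℝ) (μ : κ → ℝ) (S : Matrix ι κ ℂ) (R : Matrix κ κ ℂ) : Matrix κ κ ℂ :=
  Sᴴ * rdiag a * S + Rᴴ * rdiag μ * R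

theorem rdiag_sumElim (a : ι → ℝ) (b : ν → ℝ) :
    rdiag (Sum.elim a b) = fromBlocks (rdiag a) 0 0 (rdiag b) := by
  rw [rdiag, rdiag, rdiag, fromBlocks_diagonal]
  congr 1
  ext i
  rcases i with i | i <;> rfl

theorem norm_rdiag_sumElim_le {a : ι → ℝ} {b : ν → ℝ} {ℓ : ℝ} (ha : ‖rdiag a‖ ≤ ℓ)
    (hb : ‖rdiag b‖ ≤ ℓ) : ‖rdiag (Sum.elim a b)‖ ≤ ℓ := by
  refine norm_rdiag_le ((norm_nonneg _).trans ha) fun i => ?_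
  rcases i with i | i
  · exact (abs_le_norm_rdiag a i).trans ha
  · exact (abs_le_norm_rdiag b i).trans hb

namespace IsReduced

variable {a : ι → ℝ} {b : ν → ℝ} {μ : κ → ℝ} {ε ℓ : ℝ} {D : Matrix ι ι ℂ}
  {G : Matrix ν ι ℂ} {S : Matrix ι κ ℂ} {H : Matrix ν κ ℂ} {R : Matrix κ κ ℂ}

theorem nonneg (h : IsReduced a b μ ε ℓ D G S H R) : 0 ≤ ε ∧ 0 ≤ ℓ :=
  ⟨(norm_nonneg _).trans h.norm_G, (norm_nonneg _).trans h.norm_a⟩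

theorem compression (h : IsReduced a b μ ε ℓ D G S H R) :
    (blockBasis D G S H R)ᴴ * rdiag (Sum.elim a b) * blockBasis D G S H R =
      fromBlocks (block₁₁ a b D G) (block₁₂ a b D G S H R) (block₁₂ a b D G S H R)ᴴ
        (block₂₂ a μ S R) := by
  rw [rdiag_sumElim, blockBasis, fromBlocks_conjTranspose, fromBlocks_multiply,
    fromBlocks_multiply, block₁₁, block₁₂, block₂₂, ← h.diag_H]
  simp only [conjTranspose_mul, conjTranspose_add, conjTranspose_conjTranspose, h.herm_D,
    rdiag_conjTranspose, Matrix.mul_zero, add_zero, zero_add, Matrix.mul_assoc]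

/-- Telescoping: `E* M E - M = (E - 1)* M E + M (E - 1)`. With `t = ε²` this gives two of the three
`ε² ℓ` in each diagonal block error; the third comes from the `G` or `S` term. -/
theorem norm_conj_sub_le {M E : Matrix ι ι ℂ} {ℓ t : ℝ} (hM : ‖M‖ ≤ ℓ)
    (hE : ‖E‖ ≤ 1) (hE' : ‖E - 1‖ ≤ t) : ‖Eᴴ * M * E - M‖ ≤ 2 * t * ℓ := by
  have e : Eᴴ * M * E - M = (E - 1)ᴴ * M * E + M * (E - 1) := by
    simp only [conjTranspose_sub, conjTranspose_one]
    noncomm_ring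
  rw [e]
  have h1 := norm_matmul_le (norm_matmul_le (norm_conjTranspose_le hE') hM) hE
  have h2 := norm_matmul_le hM hE'
  refine (norm_add_le _ _).trans ?_
  linarith

theorem norm_block₁₁_sub_le (h : IsReduced a b μ ε ℓ D G S H R) :
    ‖block₁₁ a b D G - rdiag a‖ ≤ 3 * ε ^ 2 * ℓ := by
  have h1 := norm_conj_sub_le h.norm_a h.norm_D h.norm_D_sub
  rw [h.herm_D] at h1
  have h2 := norm_matmul_le (norm_matmul_le (norm_matmul_le (norm_matmul_le h.norm_D
    (norm_conjTranspose_le h.norm_G)) h.norm_b) h.norm_G) h.norm_D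
  rw [block₁₁, add_sub_right_comm]
  refine (norm_add_le _ _).trans ?_
  linarith

theorem norm_block₁₂_le (h : IsReduced a b μ ε ℓ D G S H R) :
    ‖block₁₂ a b D G S H R‖ ≤ 2 * ε * ℓ := by
  have h1 := norm_matmul_le (norm_matmul_le h.norm_D h.norm_a) h.norm_S
  have h2 := norm_matmul_le (norm_matmul_le (norm_matmul_le (norm_matmul_le h.norm_D
    (norm_conjTranspose_le h.norm_G)) h.norm_b) (norm_le_one_of_isometry h.isometry_H)) h.norm_R
  rw [block₁₂]
  refine (norm_add_le _ _).trans ?_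
  linarith

theorem norm_diag_le (h : IsReduced a b μ ε ℓ D G S H R) : ‖rdiag μ‖ ≤ ℓ := by
  have hH := norm_le_one_of_isometry h.isometry_H
  have := norm_matmul_le (norm_matmul_le (norm_conjTranspose_le hH) h.norm_b) hH
  rw [h.diag_H] at this
  linarith

theorem norm_block₂₂_sub_le (h : IsReduced a b μ ε ℓ D G S H R) :
    ‖block₂₂ a μ S R - rdiag μ‖ ≤ 3 * ε ^ 2 * ℓ := by
  have h1 := norm_conj_sub_le h.norm_diag_le h.norm_R h.norm_R_sub
  have h2 := norm_matmul_le (norm_matmul_le (norm_conjTranspose_le h.norm_S) h.norm_a) h.norm_S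
  rw [block₂₂, add_sub_assoc]
  refine (norm_add_le _ _).trans ?_
  linarith

end IsReduced

/-- Cauchy-Schwarz block by block. The coupling is kept as a product of the two component norms
instead of being absorbed into `vnorm u ^ 2`, since a gap can exploit only the former. -/
theorem re_form_fromBlocks_sub_le {P : Matrix ι ι ℂ} {E : Matrix ι κ ℂ} {T : Matrix κ κ ℂ}
    {a : ι → ℝ} {μ : κ → ℝ} {c e : ℝ} (hP : ‖P - rdiag a‖ ≤ c) (hE : ‖E‖ ≤ e)
    (hT : ‖T - rdiag μ‖ ≤ c) (u : ι ⊕ κ → ℂ) :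
    |(star u ⬝ᵥ (fromBlocks P E Eᴴ T *ᵥ u)).re -
      ((∑ i, a i * ‖u (.inl i)‖ ^ 2) + (∑ l, μ l * ‖u (.inr l)‖ ^ 2))| ≤
      c * vnorm u ^ 2 + 2 * e * vnorm (u ∘ Sum.inl) * vnorm (u ∘ Sum.inr) := by
  set x := u ∘ Sum.inl with hx
  set y := u ∘ Sum.inr with hy
  have hs : star u = Sum.elim (star x) (star y) := by
    ext i
    rcases i with i | i <;> rfl
  have key : star u ⬝ᵥ (fromBlocks P E Eᴴ T *ᵥ u) -
      ((((∑ i, a i * ‖u (.inl i)‖ ^ 2) + (∑ l, μ l * ‖u (.inr l)‖ ^ 2) : ℝ)) : ℂ) =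
      star x ⬝ᵥ ((P - rdiag a) *ᵥ x) + star x ⬝ᵥ (E *ᵥ y) + star y ⬝ᵥ (Eᴴ *ᵥ x) +
        star y ⬝ᵥ ((T - rdiag μ) *ᵥ y) := by
    rw [Complex.ofReal_add]
    have f1 := form_rdiag a x
    have f2 := form_rdiag μ y
    simp only [hx, hy, Function.comp] at f1 f2
    rw [← f1, ← f2, hs, fromBlocks_mulVec, sumElim_dotProduct_sumElim, sub_mulVec, sub_mulVec,
      dotProduct_sub, dotProduct_sub, dotProduct_add, dotProduct_add]
    simp only [hx, hy, Function.comp_def]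
    ring
  have hre := congrArg Complex.re key
  rw [Complex.sub_re, Complex.ofReal_re] at hre
  rw [hre]
  refine (Complex.abs_re_le_norm _).trans ?_
  have hx0 := vnorm_nonneg x
  have hy0 := vnorm_nonneg y
  have b1 := norm_form_le (P - rdiag a) x x
  have b2 := norm_form_le E x y
  have b3 := norm_form_le Eᴴ y x
  have b4 := norm_form_le (T - rdiag μ) y y
  rw [l2_opNorm_conjTranspose] at b3
  have c1 : ‖P - rdiag a‖ * vnorm x * vnorm x ≤ c * vnorm x * vnorm x := by gcongr
  have c2 : ‖E‖ * vnorm x * vnorm y ≤ e * vnorm x * vnorm y := by gcongr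
  have c3 : ‖E‖ * vnorm y * vnorm x ≤ e * vnorm y * vnorm x := by gcongr
  have c4 : ‖T - rdiag μ‖ * vnorm y * vnorm y ≤ c * vnorm y * vnorm y := by gcongr
  rw [vnorm_sum_sq]
  refine (norm_add_le _ _).trans ((add_le_add_left (norm_add_le _ _) _).trans
    ((add_le_add_left (add_le_add_left (norm_add_le _ _) _) _).trans ?_))
  linarith

theorem rdiag_sub_const_mulVec (d : ι → ℝ) (t : ℝ) (v : ι → ℂ) :
    rdiag (fun i => d i - t) *ᵥ v = rdiag d *ᵥ v - (t : ℂ) • v := by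
  ext i
  simp [rdiag, mulVec_diagonal, sub_mul]

theorem mul_vnorm_le_vnorm_rdiag {d : ι → ℝ} {g : ℝ} (h : ∀ i, g ≤ |d i|) (v : ι → ℂ) :
    g * vnorm v ≤ vnorm (rdiag d *ᵥ v) := by
  rcases le_or_gt g 0 with hg | hg
  · exact (mul_nonpos_of_nonpos_of_nonneg hg (vnorm_nonneg v)).trans (vnorm_nonneg _)
  · refine le_of_sq_le_sq ?_ (vnorm_nonneg _)
    rw [mul_pow, vnorm_sq, vnorm_sq, mul_sum]
    refine sum_le_sum fun i _ => ?_
    simp only [rdiag, mulVec_diagonal, norm_mul, mul_pow, Complex.norm_real, Real.norm_eq_abs]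
    gcongr
    exact h i

/-- An eigenvector `(x, y)` of a nearly block diagonal matrix has a small component `y` if the
eigenvalue is far from the spectrum of the second block. -/
theorem mul_vnorm_inr_le {P : Matrix ι ι ℂ} {E : Matrix ι κ ℂ} {T : Matrix κ κ ℂ}
    {μ : κ → ℝ} {c e g t : ℝ} (hE : ‖E‖ ≤ e) (hT : ‖T - rdiag μ‖ ≤ c) {u : ι ⊕ κ → ℂ}
    (hu : fromBlocks P E Eᴴ T *ᵥ u = (t : ℂ) • u) (hg : ∀ l, g ≤ |μ l - t|) :
    g * vnorm (u ∘ Sum.inr) ≤ e * vnorm (u ∘ Sum.inl) + c * vnorm (u ∘ Sum.inr) := by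
  set x := u ∘ Sum.inl
  set y := u ∘ Sum.inr
  have h2 : Eᴴ *ᵥ x + T *ᵥ y = (t : ℂ) • y := by
    have := congrArg (fun w => w ∘ Sum.inr) hu
    simp only [fromBlocks_mulVec, Sum.elim_comp_inr] at this
    exact this
  have h3 : rdiag (fun l => μ l - t) *ᵥ y = -(Eᴴ *ᵥ x + (T - rdiag μ) *ᵥ y) := by
    rw [rdiag_sub_const_mulVec, ← h2, sub_mulVec]
    abel
  refine (mul_vnorm_le_vnorm_rdiag hg y).trans ?_
  rw [h3, vnorm_neg]
  exact (vnorm_add_le _ _).trans (add_le_add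
    (vnorm_mulVec_le_of_le (norm_conjTranspose_le hE) le_rfl)
    (vnorm_mulVec_le_of_le hT le_rfl))

theorem vnorm_sumElim_le (v : ι → ℂ) (w : κ → ℂ) :
    vnorm (Sum.elim v w) ≤ vnorm v + vnorm w := by
  refine le_of_sq_le_sq ?_ (add_nonneg (vnorm_nonneg _) (vnorm_nonneg _))
  rw [vnorm_sum_sq, Sum.elim_comp_inl, Sum.elim_comp_inr]
  nlinarith [mul_nonneg (vnorm_nonneg v) (vnorm_nonneg w)]

namespace IsReduced

variable {a : ι → ℝ} {b : ν → ℝ} {μ : κ → ℝ} {ε ℓ : ℝ} {D : Matrix ι ι ℂ}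
  {G : Matrix ν ι ℂ} {S : Matrix ι κ ℂ} {H : Matrix ν κ ℂ} {R : Matrix κ κ ℂ}

theorem norm_rdiag_sub_const_le {d : ι → ℝ} {t : ℝ} (hd : ‖rdiag d‖ ≤ ℓ) (ht : |t| ≤ ℓ) :
    ‖rdiag fun i => d i - t‖ ≤ 2 * ℓ := by
  refine norm_rdiag_le (by linarith [abs_nonneg t]) fun i => ?_
  have := (abs_le_norm_rdiag d i).trans hd
  exact (abs_sub _ _).trans (by linarith)

/-- The residual of a Ritz pair. -/
theorem vnorm_residual_le (h : IsReduced a b μ ε ℓ D G S H R) {u : ι ⊕ κ → ℂ} {t : ℝ}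
    (hu : ((blockBasis D G S H R)ᴴ * rdiag (Sum.elim a b) * blockBasis D G S H R) *ᵥ u =
      (t : ℂ) • u) (ht : |t| ≤ ℓ) (hu1 : vnorm u ≤ 1) :
    vnorm (rdiag (fun i => Sum.elim a b i - t) *ᵥ (blockBasis D G S H R *ᵥ u)) ≤
      ℓ * (2 * ε + 5 * ε ^ 2 + (2 + 4 * ε) * vnorm (u ∘ Sum.inr)) := by
  obtain ⟨hε, hℓ⟩ := h.nonneg
  set x := u ∘ Sum.inl with hx
  set y := u ∘ Sum.inr with hy
  have hx1 : vnorm x ≤ 1 := by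
    have := vnorm_sum_sq u
    nlinarith [vnorm_nonneg x, vnorm_nonneg u, sq_nonneg (vnorm y)]
  have hy0 := vnorm_nonneg y
  have h1 : block₁₁ a b D G *ᵥ x + block₁₂ a b D G S H R *ᵥ y = (t : ℂ) • x := by
    rw [h.compression] at hu
    have := congrArg (fun w => w ∘ Sum.inl) hu
    simp only [fromBlocks_mulVec, Sum.elim_comp_inl] at this
    exact this
  have hsplit : rdiag (fun i => Sum.elim a b i - t) *ᵥ (blockBasis D G S H R *ᵥ u) =
      Sum.elim (rdiag (fun i => a i - t) *ᵥ (D *ᵥ x + S *ᵥ y))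
        (rdiag (fun i => b i - t) *ᵥ (G *ᵥ (D *ᵥ x) + H *ᵥ (R *ᵥ y))) := by
    have : (fun i => Sum.elim a b i - t) = Sum.elim (fun i => a i - t) (fun i => b i - t) := by
      ext i
      rcases i with i | i <;> rfl
    rw [this, rdiag_sumElim, blockBasis, fromBlocks_mulVec, fromBlocks_mulVec]
    simp only [Sum.elim_comp_inl, Sum.elim_comp_inr, mulVec_mulVec, zero_mulVec, add_zero,
      zero_add, hx, hy]
  have hA := norm_rdiag_sub_const_le h.norm_a ht
  have hB := norm_rdiag_sub_const_le h.norm_b ht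
  -- The first row of the eigenvector equation expresses `(diag(a) - t) x` through the block errors,
  -- so the leading part needs no a priori bound on `a i - t`. The remaining terms are small through
  -- `D - 1`, `S`, `G` or `y`.
  have htop : rdiag (fun i => a i - t) *ᵥ (D *ᵥ x + S *ᵥ y) =
      -((block₁₁ a b D G - rdiag a) *ᵥ x + block₁₂ a b D G S H R *ᵥ y) +
      rdiag (fun i => a i - t) *ᵥ ((D - 1) *ᵥ x) + rdiag (fun i => a i - t) *ᵥ (S *ᵥ y) := by
    have : rdiag (fun i => a i - t) *ᵥ x =
        -((block₁₁ a b D G - rdiag a) *ᵥ x + block₁₂ a b D G S H R *ᵥ y) := by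
      rw [rdiag_sub_const_mulVec, ← h1, sub_mulVec]
      abel
    rw [← this, sub_mulVec, one_mulVec, mulVec_sub, mulVec_add]
    abel
  have t1 := vnorm_mulVec_le_of_le h.norm_block₁₁_sub_le hx1
  have t2 := vnorm_mulVec_le_of_le h.norm_block₁₂_le (le_refl (vnorm y))
  have t3 := vnorm_mulVec_le_of_le hA (vnorm_mulVec_le_of_le h.norm_D_sub hx1)
  have t4 := vnorm_mulVec_le_of_le hA (vnorm_mulVec_le_of_le h.norm_S (le_refl (vnorm y)))
  have t5 := vnorm_mulVec_le_of_le hB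
    ((vnorm_add_le _ _).trans (add_le_add
      (vnorm_mulVec_le_of_le h.norm_G (vnorm_mulVec_le_of_le h.norm_D hx1))
      (vnorm_mulVec_le_of_le (norm_le_one_of_isometry h.isometry_H)
        (vnorm_mulVec_le_of_le h.norm_R (le_refl (vnorm y))))))
  rw [hsplit]
  refine (vnorm_sumElim_le _ _).trans ?_
  rw [htop]
  have t6 := vnorm_add_le (-((block₁₁ a b D G - rdiag a) *ᵥ x + block₁₂ a b D G S H R *ᵥ y) +
      rdiag (fun i => a i - t) *ᵥ ((D - 1) *ᵥ x)) (rdiag (fun i => a i - t) *ᵥ (S *ᵥ y))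
  have t7 := vnorm_add_le (-((block₁₁ a b D G - rdiag a) *ᵥ x + block₁₂ a b D G S H R *ᵥ y))
      (rdiag (fun i => a i - t) *ᵥ ((D - 1) *ᵥ x))
  have t8 := vnorm_add_le ((block₁₁ a b D G - rdiag a) *ᵥ x) (block₁₂ a b D G S H R *ᵥ y)
  rw [vnorm_neg] at t7
  nlinarith

end IsReduced

/-- Here `Y` is the norm of the `μ`-component and `w = ℓ / δ` is the inverse relative gap. The
trivial bound `2 ℓ` suffices once `6 ε (1 + w) ≥ 1`; otherwise `ε` and `ε w` are at most `1/6`, and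
the Ritz value stays well separated from `μ`. -/
theorem residual_bound {ε ℓ δ τ Y r : ℝ} (hε : 0 ≤ ε) (hℓ : 0 ≤ ℓ) (hδ : 0 < δ) (hY : 0 ≤ Y)
    (hτ : τ ≤ 4 * ε ^ 2 * ℓ ^ 2 / δ)
    (hYb : (δ - (3 * ε ^ 2 * ℓ + τ)) * Y ≤ 2 * ε * ℓ + 3 * ε ^ 2 * ℓ * Y)
    (hY1 : Y ≤ 1) (hr2 : r ≤ 2 * ℓ) (hr : r ≤ ℓ * (2 * ε + 5 * ε ^ 2 + (2 + 4 * ε) * Y)) :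
    r ≤ 12 * ℓ * ε * (1 + ℓ / δ) := by
  obtain ⟨w, hw⟩ : ∃ w, w = ℓ / δ := ⟨_, rfl⟩
  have hw0 : 0 ≤ w := by rw [hw]; positivity
  have hℓw : ℓ = w * δ := by rw [hw]; field_simp
  rw [← hw]
  rcases le_or_gt 1 (6 * (ε * (1 + w))) with hc | hc
  · nlinarith
  · have hτ' : τ ≤ 4 * (ε * w) ^ 2 * δ := by
      have : 4 * ε ^ 2 * ℓ ^ 2 / δ = 4 * (ε * w) ^ 2 * δ := by
        rw [hℓw]; field_simp
      rwa [this] at hτ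
    have hεw : 0 ≤ ε * w := by positivity
    have e6 : ε ≤ 1 / 6 := by nlinarith
    have ew6 : ε * w ≤ 1 / 6 := by nlinarith
    have g1 : 3 * ε ^ 2 * ℓ ≤ 1 / 12 * δ := by
      rw [hℓw]
      have : ε * (ε * w) ≤ 1 / 6 * (1 / 6) := mul_le_mul e6 ew6 hεw (by norm_num)
      nlinarith
    have g2 : 4 * (ε * w) ^ 2 * δ ≤ 1 / 9 * δ := by
      have : (ε * w) ^ 2 ≤ (1 / 6) ^ 2 := pow_le_pow_left₀ hεw ew6 2
      nlinarith
    -- The gap left is at least `(1 - 1/12 - 1/9) δ = 29/36 δ`.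
    have g3 : 29 / 36 * δ * Y ≤ (2 * (ε * w) + 3 * ε * (ε * w)) * δ := by
      have i1 : 29 / 36 * δ * Y ≤ (δ - (3 * ε ^ 2 * ℓ + τ)) * Y := by
        apply mul_le_mul_of_nonneg_right _ hY
        linarith
      have i2 : 3 * ε ^ 2 * ℓ * Y ≤ 3 * ε ^ 2 * ℓ * 1 := by gcongr
      rw [hℓw] at i2 hYb i1
      linarith
    have g4 : 29 / 36 * Y ≤ 2 * (ε * w) + 3 * ε * (ε * w) := by
      refine le_of_mul_le_mul_right ?_ hδ
      linarith
    have g5 : Y ≤ 90 / 29 * (ε * w) := by nlinarith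
    refine hr.trans ?_
    have g6 : (2 + 4 * ε) * Y ≤ 8 / 3 * (90 / 29 * (ε * w)) :=
      mul_le_mul (by linarith) g5 hY (by norm_num)
    have g7 : 5 * ε ^ 2 ≤ ε := by nlinarith
    have g8 : 2 * ε + 5 * ε ^ 2 + (2 + 4 * ε) * Y ≤ 12 * ε * (1 + w) := by nlinarith
    calc _ ≤ ℓ * (12 * ε * (1 + w)) := by gcongr
      _ = _ := by ring

end BlockBasis

/-! ### Reduction of an orthonormal block basis, and Ritz estimates for it. -/

section RitzEstimates

open Matrix Finset

variable {ι κ ν : Type*} [Fintype ι] [DecidableEq ι] [Fintype κ] [DecidableEq κ]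
  [Fintype ν] [DecidableEq ν]

section Orthonormal

variable {L : Matrix ι ι ℂ} {G : Matrix ν ι ℂ} {S : Matrix ι κ ℂ} {T : Matrix ν κ ℂ}

/-- A factor `L` of `1 + Gᴴ * G` is invertible, with inverse `D * (L * D)ᴴ` where `D` is the
inverse square root of `1 + Gᴴ * G` and `L * D` is unitary. -/
theorem inv_factor_eq {D : Matrix ι ι ℂ} (hL : Lᴴ * L = 1 + Gᴴ * G) (hD : Dᴴ = D)
    (hD1 : D * (1 + Gᴴ * G) * D = 1) :
    (L * D)ᴴ * (L * D) = 1 ∧ (L * D) * (L * D)ᴴ = 1 ∧ L * L⁻¹ = 1 ∧ L⁻¹ = D * (L * D)ᴴ := by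
  have h1 : (L * D)ᴴ * (L * D) = 1 := by
    rw [conjTranspose_mul, hD, ← hD1, ← hL]
    simp only [Matrix.mul_assoc]
  have h2 : (L * D) * (L * D)ᴴ = 1 := mul_eq_one_comm.1 h1
  have h3 : L * (D * (L * D)ᴴ) = 1 := by rw [← Matrix.mul_assoc, h2]
  have h4 := Matrix.inv_eq_right_inv h3
  exact ⟨h1, h2, by rw [h4, h3], h4⟩

/-- The off-diagonal block of `Z* Z = 1` reads `(L⁻¹)* (S + G* T) = 0`, and the invertible factor
cancels. -/
theorem orthonormal_blocks (hL : L * L⁻¹ = 1)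
    (hZ : (fromBlocks L⁻¹ S (G * L⁻¹) T)ᴴ * fromBlocks L⁻¹ S (G * L⁻¹) T = 1) :
    S = -(Gᴴ * T) ∧ Sᴴ * S + Tᴴ * T = 1 := by
  rw [fromBlocks_conjTranspose, fromBlocks_multiply, ← fromBlocks_one, fromBlocks_inj] at hZ
  obtain ⟨-, h2, -, h4⟩ := hZ
  refine ⟨?_, h4⟩
  have h5 : Lᴴ * (L⁻¹)ᴴ = 1 := by rw [← conjTranspose_mul, mul_eq_one_comm.1 hL, conjTranspose_one]
  have h6 : Lᴴ * ((L⁻¹)ᴴ * S + (G * L⁻¹)ᴴ * T) = S + Gᴴ * T := by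
    rw [conjTranspose_mul, Matrix.mul_add, ← Matrix.mul_assoc, ← Matrix.mul_assoc,
      ← Matrix.mul_assoc, h5, Matrix.one_mul, Matrix.one_mul]
  rw [h2, Matrix.mul_zero] at h6
  exact eq_neg_of_add_eq_zero_left h6.symm

theorem norm_le_one_of_gram_add {S : Matrix ι κ ℂ} {T : Matrix ν κ ℂ}
    (h : Sᴴ * S + Tᴴ * T = 1) : ‖T‖ ≤ 1 := by
  refine norm_le_of_vnorm_mulVec_le T zero_le_one fun v => ?_
  have h1 := vnorm_mulVec_sq S v
  have h2 := vnorm_mulVec_sq T v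
  have h3 : ((vnorm (S *ᵥ v) ^ 2 + vnorm (T *ᵥ v) ^ 2 : ℝ) : ℂ) = ((vnorm v ^ 2 : ℝ) : ℂ) := by
    rw [Complex.ofReal_add, h1, h2, ← dotProduct_add, ← add_mulVec, h, one_mulVec,
      star_dotProduct_self]
  have h4 := Complex.ofReal_injective h3
  rw [one_mul]
  refine le_of_sq_le_sq ?_ (vnorm_nonneg _)
  linarith [sq_nonneg (vnorm (S *ᵥ v))]

/-- From `S = -G* T`, where `T` is a contraction because `S* S + T* T = 1`. -/
theorem norm_coupling_le (hL : L * L⁻¹ = 1)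
    (hZ : (fromBlocks L⁻¹ S (G * L⁻¹) T)ᴴ * fromBlocks L⁻¹ S (G * L⁻¹) T = 1) :
    ‖S‖ ≤ ‖G‖ := by
  obtain ⟨h1, h2⟩ := orthonormal_blocks hL hZ
  have := norm_matmul_le (norm_conjTranspose_le (le_refl ‖G‖)) (norm_le_one_of_gram_add h2)
  rw [h1, norm_neg]
  linarith

/-- Polar decomposition of the second block column. -/
theorem exists_polar_factorization (hL : L * L⁻¹ = 1)
    (hZ : (fromBlocks L⁻¹ S (G * L⁻¹) T)ᴴ * fromBlocks L⁻¹ S (G * L⁻¹) T = 1) (hG : ‖G‖ < 1) :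
    ∃ (H : Matrix ν κ ℂ) (R : Matrix κ κ ℂ), T = H * R ∧ Hᴴ * H = 1 ∧ ‖R - 1‖ ≤ ‖G‖ ^ 2 := by
  obtain ⟨h1, h2⟩ := orthonormal_blocks hL hZ
  have hS := norm_coupling_le hL hZ
  obtain ⟨R, P, hR, hP, hRR, hRP, hPR, hR1, -⟩ := exists_sqrt_one_sub_gram S (hS.trans_lt hG)
  refine ⟨T * P, R, ?_, ?_, hR1.trans (by gcongr)⟩
  · rw [Matrix.mul_assoc, hPR, Matrix.mul_one]
  · have h3 : Tᴴ * T = R * R := by rw [hRR, ← h2]; abel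
    calc (T * P)ᴴ * (T * P) = P * (Tᴴ * T) * P := by
          rw [conjTranspose_mul, hP]; simp only [Matrix.mul_assoc]
      _ = (P * R) * (R * P) := by rw [h3]; simp only [Matrix.mul_assoc]
      _ = 1 := by rw [hPR, hRP, Matrix.mul_one]

/-- Every orthonormal block basis is, up to a unitary factor, one of the form required by
`IsReduced`. -/
theorem exists_isReduced {H : Matrix ν κ ℂ} {R : Matrix κ κ ℂ} (a : ι → ℝ) (b : ν → ℝ) {ℓ : ℝ}
    (ha : ‖rdiag a‖ ≤ ℓ) (hb : ‖rdiag b‖ ≤ ℓ) (hL : Lᴴ * L = 1 + Gᴴ * G)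
    (hZ : (fromBlocks L⁻¹ S (G * L⁻¹) (H * R))ᴴ * fromBlocks L⁻¹ S (G * L⁻¹) (H * R) = 1)
    (hG : ‖G‖ < 1) (hH : Hᴴ * H = 1) :
    ∃ (D : Matrix ι ι ℂ) (S' : Matrix ι κ ℂ) (H' : Matrix ν κ ℂ) (R' : Matrix κ κ ℂ) (μ : κ → ℝ)
      (W : Matrix (ι ⊕ κ) (ι ⊕ κ) ℂ), IsReduced a b μ ‖G‖ ℓ D G S' H' R' ∧
      fromBlocks L⁻¹ S (G * L⁻¹) (H * R) = blockBasis D G S' H' R' * W ∧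
      Wᴴ * W = 1 ∧ W * Wᴴ = 1 ∧ ∀ l, μ l ∈ spectrum ℝ (Hᴴ * rdiag b * H) := by
  obtain ⟨D, hD, hD1, hDn, hDs⟩ := exists_inv_sqrt_one_add_gram G
  obtain ⟨hΩ, hΩ', hLL, hLinv⟩ := inv_factor_eq hL hD hD1
  obtain ⟨h1, h2⟩ := orthonormal_blocks hLL hZ
  have hS := norm_coupling_le hLL hZ
  obtain ⟨R₀, P, hR₀, hP, hRR, hRP, hPR, hR1, hRn⟩ :=
    exists_sqrt_one_sub_gram S (hS.trans_lt hG)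
  have hherm : (Hᴴ * rdiag b * H).IsHermitian := by
    simp [IsHermitian, conjTranspose_mul, rdiag_conjTranspose, Matrix.mul_assoc]
  obtain ⟨F, μ, hF, hF', hK, hμ⟩ := exists_diagonalization hherm
  -- Nothing is assumed on the size of `R`. Since `R* R = 1 - S* S = R₀²`, the factor `Ω = R R₀⁻¹`
  -- is unitary, and `R₀` supplies the estimates.
  set Ω := R * P with hΩdef
  have hRΩ : R = Ω * R₀ := by rw [hΩdef, Matrix.mul_assoc, hPR, Matrix.mul_one]
  have hRgram : Rᴴ * R = R₀ * R₀ := by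
    have : (H * R)ᴴ * (H * R) = Rᴴ * R := by
      rw [conjTranspose_mul, Matrix.mul_assoc, ← Matrix.mul_assoc Hᴴ, hH, Matrix.one_mul]
    rw [hRR, ← h2, this]
    abel
  have hΩu : Ωᴴ * Ω = 1 := by
    calc Ωᴴ * Ω = P * (Rᴴ * R) * P := by
          rw [hΩdef, conjTranspose_mul, hP]; simp only [Matrix.mul_assoc]
      _ = (P * R₀) * (R₀ * P) := by rw [hRgram]; simp only [Matrix.mul_assoc]
      _ = 1 := by rw [hPR, hRP, Matrix.mul_one]
  have hΩu' : Ω * Ωᴴ = 1 := mul_eq_one_comm.1 hΩu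
  -- Replacing `H` by `H F` diagonalizes the compression; `E` compensates through `H R = (H F) (E R₀
  -- E*) E`, and the middle factor is still close to `1`.
  set E := Fᴴ * Ω with hE
  have hEu : Eᴴ * E = 1 := by
    rw [hE, conjTranspose_mul, conjTranspose_conjTranspose, Matrix.mul_assoc,
      ← Matrix.mul_assoc F, hF', Matrix.one_mul, hΩu]
  have hEu' : E * Eᴴ = 1 := mul_eq_one_comm.1 hEu
  have hEn' : (Eᴴ)ᴴ * Eᴴ = 1 := by rw [conjTranspose_conjTranspose, hEu']
  refine ⟨D, S * Eᴴ, H * F, E * R₀ * Eᴴ, μ, fromBlocks (L * D)ᴴ 0 0 E,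
    ⟨ha, hb, le_rfl, ?_, hD, hDn, hDs, ?_, ?_, ?_, ?_⟩, ?_, ?_, ?_, hμ⟩
  · have := norm_matmul_le hS (norm_le_one_of_isometry hEn')
    linarith
  · rw [conjTranspose_mul, Matrix.mul_assoc, ← Matrix.mul_assoc Hᴴ, hH, Matrix.one_mul, hF]
  · calc _ = Fᴴ * (Hᴴ * rdiag b * H) * F := by
          rw [conjTranspose_mul]; simp only [Matrix.mul_assoc]
      _ = (Fᴴ * F) * rdiag μ * (Fᴴ * F) := by rw [hK]; simp only [Matrix.mul_assoc]
      _ = _ := by rw [hF, Matrix.one_mul, Matrix.mul_one]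
  · exact (norm_conj_unitary_le hEu _).trans hRn
  · have : E * R₀ * Eᴴ - 1 = E * (R₀ - 1) * Eᴴ := by
      rw [Matrix.mul_sub, Matrix.sub_mul, Matrix.mul_one, hEu']
    rw [this]
    exact (norm_conj_unitary_le hEu _).trans (hR1.trans (by gcongr))
  · rw [blockBasis, fromBlocks_multiply, fromBlocks_inj]
    simp only [Matrix.mul_zero, add_zero, zero_add]
    refine ⟨hLinv, ?_, ?_, ?_⟩
    · rw [Matrix.mul_assoc, hEu, Matrix.mul_one]
    · conv_lhs => rw [hLinv]
      rw [Matrix.mul_assoc]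
    · conv_lhs => rw [hRΩ]
      calc H * (Ω * R₀) = H * (F * Fᴴ) * Ω * R₀ * (Eᴴ * E) := by
            rw [hF', hEu]; simp only [Matrix.mul_assoc, Matrix.mul_one]
        _ = _ := by rw [hE]; simp only [Matrix.mul_assoc]
  · rw [fromBlocks_conjTranspose, fromBlocks_multiply, ← fromBlocks_one]
    simp only [conjTranspose_conjTranspose, conjTranspose_zero, Matrix.mul_zero, Matrix.zero_mul,
      add_zero, zero_add, hΩ', hEu]
  · rw [fromBlocks_conjTranspose, fromBlocks_multiply, ← fromBlocks_one]
    simp only [conjTranspose_conjTranspose, conjTranspose_zero, Matrix.mul_zero, Matrix.zero_mul,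
      add_zero, zero_add, hΩ, hEu']

end Orthonormal

namespace IsReduced

variable {a : ι → ℝ} {b : ν → ℝ} {μ : κ → ℝ} {ε ℓ : ℝ} {D : Matrix ι ι ℂ}
  {G : Matrix ν ι ℂ} {S : Matrix ι κ ℂ} {H : Matrix ν κ ℂ} {R : Matrix κ κ ℂ}
  {N : ℕ} {U : Matrix (ι ⊕ κ) (Fin N) ℂ} {α : Fin N → ℝ}

/-- The parameters `e`, `τ`, `δ` stay free to cover three regimes: no gap (`δ = 0`, `τ = e`), a
positive gap, and an empty second block (all zero). -/
theorem exists_matching (h : IsReduced a b μ ε ℓ D G S H R) (hN : Fintype.card (ι ⊕ κ) = N)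
    (hU : U * Uᴴ = 1)
    (hNU : (blockBasis D G S H R)ᴴ * rdiag (Sum.elim a b) * blockBasis D G S H R =
      U * rdiag α * Uᴴ) {e τ δ : ℝ} (hE : ‖block₁₂ a b D G S H R‖ ≤ e)
    (hτ : 0 ≤ τ) (hδ : 0 ≤ δ) (he : e ^ 2 ≤ τ * (δ + τ)) (hgap : ∀ j l, δ ≤ |a j - μ l|) :
    ∃ σ : ι ↪ Fin N, ∀ j, |a j - α (σ j)| ≤ 3 * ε ^ 2 * ℓ + τ := by
  refine exists_eigenvalue_matching hN U hU α a μ (fun u => ?_) hτ hδ he hgap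
  rw [← hNU, h.compression]
  exact re_form_fromBlocks_sub_le h.norm_block₁₁_sub_le hE h.norm_block₂₂_sub_le u

theorem eigenvector (hU : Uᴴ * U = 1) {M : Matrix (ι ⊕ κ) (ι ⊕ κ) ℂ}
    (hM : M = U * rdiag α * Uᴴ) (r : Fin N) : M *ᵥ U.col r = (α r : ℂ) • U.col r := by
  have h1 : M * U = U * rdiag α := by rw [hM, Matrix.mul_assoc, hU, Matrix.mul_one]
  ext i
  have := congrFun (congrFun h1 i) r
  simp only [rdiag, mul_diagonal] at this
  simp only [Pi.smul_apply, smul_eq_mul, Matrix.col_apply, mulVec, dotProduct]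
  rw [mul_comm, ← this, Matrix.mul_apply]

theorem vnorm_col (hU : Uᴴ * U = 1) (r : Fin N) : vnorm (U.col r) = 1 := by
  have h1 : U.col r = U *ᵥ Pi.single r 1 := by simp
  rw [h1, vnorm_mulVec_isometry hU]
  have : vnorm (Pi.single r (1 : ℂ)) ^ 2 = 1 := by
    rw [vnorm_sq, Finset.sum_eq_single r (fun b _ hb => by simp [hb]) (by simp)]
    simp
  exact (pow_eq_one_iff_of_nonneg (vnorm_nonneg _) two_ne_zero).1 this

theorem abs_ritzValue_le (h : IsReduced a b μ ε ℓ D G S H R) (hU : Uᴴ * U = 1)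
    (hNU : (blockBasis D G S H R)ᴴ * rdiag (Sum.elim a b) * blockBasis D G S H R =
      U * rdiag α * Uᴴ) (hZ : (blockBasis D G S H R)ᴴ * blockBasis D G S H R = 1) (r : Fin N) :
    |α r| ≤ ℓ := by
  have hα : rdiag α =
      Uᴴ * ((blockBasis D G S H R)ᴴ * rdiag (Sum.elim a b) * blockBasis D G S H R) * U := by
    rw [hNU]
    calc rdiag α = (Uᴴ * U) * rdiag α * (Uᴴ * U) := by rw [hU, Matrix.one_mul, Matrix.mul_one]
      _ = _ := by simp only [Matrix.mul_assoc]
  have hUn := norm_le_one_of_isometry hU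
  have hZn := norm_le_one_of_isometry hZ
  have := norm_matmul_le (norm_matmul_le (norm_conjTranspose_le hUn)
    (norm_matmul_le (norm_matmul_le (norm_conjTranspose_le hZn)
      (norm_rdiag_sumElim_le h.norm_a h.norm_b)) hZn)) hUn
  rw [← hα] at this
  linarith [abs_le_norm_rdiag α r]

/-- Ritz values without a gap. -/
theorem exists_matching_of_no_gap (h : IsReduced a b μ ε ℓ D G S H R)
    (hN : Fintype.card (ι ⊕ κ) = N) (hU : U * Uᴴ = 1)
    (hNU : (blockBasis D G S H R)ᴴ * rdiag (Sum.elim a b) * blockBasis D G S H R =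
      U * rdiag α * Uᴴ) :
    ∃ σ : ι ↪ Fin N, ∀ j, |a j - α (σ j)| ≤ 3 * ε ^ 2 * ℓ + 2 * ε * ℓ := by
  obtain ⟨hε, hℓ⟩ := h.nonneg
  exact h.exists_matching hN hU hNU h.norm_block₁₂_le (by positivity) le_rfl
    (le_of_eq (by ring)) fun j l => abs_nonneg _

theorem vnorm_residual_le_two_mul (h : IsReduced a b μ ε ℓ D G S H R)
    (hZ : (blockBasis D G S H R)ᴴ * blockBasis D G S H R = 1) {u : ι ⊕ κ → ℂ} {t : ℝ}
    (ht : |t| ≤ ℓ) (hu1 : vnorm u ≤ 1) :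
    vnorm (rdiag (fun i => Sum.elim a b i - t) *ᵥ (blockBasis D G S H R *ᵥ u)) ≤ 2 * ℓ := by
  have := vnorm_mulVec_le_of_le
    (norm_rdiag_sub_const_le (norm_rdiag_sumElim_le h.norm_a h.norm_b) ht)
    (vnorm_mulVec_le_of_le (norm_le_one_of_isometry hZ) hu1)
  linarith

/-- Ritz values and residuals in the presence of a gap `δ`. -/
theorem exists_matching_of_gap (h : IsReduced a b μ ε ℓ D G S H R)
    (hN : Fintype.card (ι ⊕ κ) = N) (hU : U * Uᴴ = 1) (hU' : Uᴴ * U = 1)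
    (hNU : (blockBasis D G S H R)ᴴ * rdiag (Sum.elim a b) * blockBasis D G S H R =
      U * rdiag α * Uᴴ) (hZ : (blockBasis D G S H R)ᴴ * blockBasis D G S H R = 1)
    {δ : ℝ} (hδ : 0 < δ) (hgap : ∀ j l, δ ≤ |a j - μ l|) :
    ∃ σ : ι ↪ Fin N, ∀ j,
      |a j - α (σ j)| ≤ 3 * ε ^ 2 * ℓ + min (2 * ε * ℓ) (4 * ε ^ 2 * ℓ ^ 2 / δ) ∧
      vnorm (rdiag (fun i => Sum.elim a b i - α (σ j)) *ᵥ
        (blockBasis D G S H R *ᵥ U.col (σ j))) ≤ 12 * ℓ * ε * (1 + ℓ / δ) := by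
  obtain ⟨hε, hℓ⟩ := h.nonneg
  set τ := min (2 * ε * ℓ) (4 * ε ^ 2 * ℓ ^ 2 / δ) with hτ
  have hτ0 : 0 ≤ τ := le_min (by positivity) (by positivity)
  -- With `e = 2 ε ℓ`, both `τ = e` and `τ = e² / δ` are admissible, hence so is their minimum.
  have he : (2 * ε * ℓ) ^ 2 ≤ τ * (δ + τ) := by
    rcases min_choice (2 * ε * ℓ) (4 * ε ^ 2 * ℓ ^ 2 / δ) with hc | hc <;> rw [hτ, hc]
    · have : 0 ≤ 2 * ε * ℓ * δ := by positivity
      linarith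
    · have h1 : 4 * ε ^ 2 * ℓ ^ 2 / δ * δ = 4 * ε ^ 2 * ℓ ^ 2 := by field_simp
      nlinarith [sq_nonneg (4 * ε ^ 2 * ℓ ^ 2 / δ)]
  obtain ⟨σ, hσ⟩ := h.exists_matching hN hU hNU h.norm_block₁₂_le hτ0 hδ.le he hgap
  refine ⟨σ, fun j => ⟨hσ j, ?_⟩⟩
  set u := U.col (σ j)
  have hu := eigenvector hU' hNU (σ j)
  have hu1 : vnorm u = 1 := vnorm_col hU' _
  have ht := h.abs_ritzValue_le hU' hNU hZ (σ j)
  have hx0 := vnorm_nonneg (u ∘ Sum.inl)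
  have hy0 := vnorm_nonneg (u ∘ Sum.inr)
  have hsum := vnorm_sum_sq u
  rw [hu1] at hsum
  have hx1 : vnorm (u ∘ Sum.inl) ≤ 1 := by nlinarith
  have hy1 : vnorm (u ∘ Sum.inr) ≤ 1 := by nlinarith
  refine residual_bound (τ := τ) hε hℓ hδ hy0 (min_le_right _ _) ?_ hy1
    (h.vnorm_residual_le_two_mul hZ ht hu1.le) (h.vnorm_residual_le hu ht hu1.le)
  have hu2 := hu
  rw [h.compression] at hu2
  -- The separation of the Ritz value from `μ` is `δ` minus its own displacement. It may be negative
  -- here; `residual_bound` treats that case by the trivial estimate.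
  refine (mul_vnorm_inr_le h.norm_block₁₂_le h.norm_block₂₂_sub_le hu2
    (g := δ - (3 * ε ^ 2 * ℓ + τ)) fun l => ?_).trans ?_
  · have h1 := hgap j l
    have h2 := hσ j
    have h3 := abs_sub_le (a j) (α (σ j)) (μ l)
    rw [abs_sub_comm (α (σ j))] at h3
    linarith
  · have : 2 * ε * ℓ * vnorm (u ∘ Sum.inl) ≤ 2 * ε * ℓ * 1 := by gcongr
    linarith

/-- Ritz values and residuals when the second block is absent. -/
theorem exists_matching_of_isEmpty [IsEmpty κ] (h : IsReduced a b μ ε ℓ D G S H R)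
    (hN : Fintype.card (ι ⊕ κ) = N) (hU : U * Uᴴ = 1) (hU' : Uᴴ * U = 1)
    (hNU : (blockBasis D G S H R)ᴴ * rdiag (Sum.elim a b) * blockBasis D G S H R =
      U * rdiag α * Uᴴ) (hZ : (blockBasis D G S H R)ᴴ * blockBasis D G S H R = 1)
    (hε2 : ε ≤ 1 / 2) :
    ∃ σ : ι ↪ Fin N, ∀ j, |a j - α (σ j)| ≤ 3 * ε ^ 2 * ℓ ∧
      vnorm (rdiag (fun i => Sum.elim a b i - α (σ j)) *ᵥ
        (blockBasis D G S H R *ᵥ U.col (σ j))) ≤ 12 * ℓ * ε := by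
  obtain ⟨hε, hℓ⟩ := h.nonneg
  have hE : ‖block₁₂ a b D G S H R‖ ≤ 0 := by
    have : block₁₂ a b D G S H R = 0 := by
      ext i l
      exact isEmptyElim l
    rw [this, norm_zero]
  obtain ⟨σ, hσ⟩ := h.exists_matching hN hU hNU hE le_rfl le_rfl (by norm_num)
    fun j l => isEmptyElim l
  refine ⟨σ, fun j => ⟨by simpa using hσ j, ?_⟩⟩
  have hy : vnorm (U.col (σ j) ∘ Sum.inr) = 0 := by
    have := vnorm_sq (U.col (σ j) ∘ (Sum.inr : κ → ι ⊕ κ))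
    simpa using this
  have := h.vnorm_residual_le (eigenvector hU' hNU (σ j)) (h.abs_ritzValue_le hU' hNU hZ (σ j))
    (vnorm_col hU' _).le
  rw [hy, mul_zero, add_zero] at this
  refine this.trans ?_
  have : 2 * ε + 5 * ε ^ 2 ≤ 12 * ε := by nlinarith
  nlinarith

end IsReduced

end RitzEstimates

/-! ### Coordinates with respect to `X`, and passage to extended nonnegative reals. -/

section SplitColumns

open Matrix

theorem fromCols_headCols_tailCols {m N n : ℕ} (h : m ≤ N) (X : Matrix (Fin n) (Fin N) ℂ) :
    fromCols (headCols h X) (tailCols h X) = X.submatrix id (split h) := by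
  ext i j
  rcases j with j | j <;> rfl

theorem sumElim_headVals_tailVals {m n : ℕ} (h : m ≤ n) (lam : Fin n → ℝ) :
    Sum.elim (headVals h lam) (tailVals h lam) = lam ∘ split h := by
  ext i
  rcases i with i | i <;> rfl

theorem hcat_mul {m N n : ℕ} (h : m ≤ N) (P : Matrix (Fin n) (Fin m) ℂ)
    (V : Matrix (Fin n) (Fin (N - m)) ℂ) (U : Matrix (Fin N) (Fin N) ℂ) :
    hcat h P V * U = fromCols P V * U.submatrix (split h) id := by
  ext i j
  simp only [hcat, Matrix.mul_apply, submatrix_apply, id]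
  exact (Equiv.sum_comp (split h) _).symm.trans (by simp)

theorem submatrix_split_unitary {m N : ℕ} (h : m ≤ N) {U : Matrix (Fin N) (Fin N) ℂ}
    (hU : U ∈ unitaryGroup (Fin N) ℂ) :
    (U.submatrix (split h) id)ᴴ * U.submatrix (split h) id = 1 ∧
      U.submatrix (split h) id * (U.submatrix (split h) id)ᴴ = 1 := by
  rw [conjTranspose_submatrix]
  constructor
  · rw [submatrix_mul_equiv, submatrix_id_id]
    exact mem_unitaryGroup_iff'.1 hU
  · have : U * Uᴴ = 1 := mem_unitaryGroup_iff.1 hU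
    rw [← submatrix_mul _ _ _ _ _ Function.bijective_id, this, submatrix_one_equiv]

/-- The compression of the pencil to the basis that an iteration delivers is diagonal. -/
theorem IsIteration.compression_eq {n p : ℕ} {A B F : Matrix (Fin n) (Fin n) ℂ}
    {Q₀ Δ Y : Matrix (Fin n) (Fin p) ℂ} {Xhat : Matrix (Fin p) (Fin p) ℂ} {lamhat : Fin p → ℝ}
    {Q : Matrix (Fin n) (Fin p) ℂ} (h : IsIteration A B F Q₀ Δ Y Xhat lamhat Q) :
    Qᴴ * A * Q = rdiag lamhat := by
  calc Qᴴ * A * Q = Xhatᴴ * ((Yᴴ * A * Y) * Xhat) := by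
        rw [h.update, conjTranspose_mul]; simp only [Matrix.mul_assoc]
    _ = (Qᴴ * B * Q) * rdiag lamhat := by
        rw [h.reduced, h.update, conjTranspose_mul]; simp only [Matrix.mul_assoc]
    _ = rdiag lamhat := by rw [h.orthonormal, Matrix.one_mul]

section Coordinates

variable {ι κ ν : Type*} [Fintype ι] [DecidableEq ι] [Fintype κ] [DecidableEq κ]
  [Fintype ν] [DecidableEq ν] {n N : ℕ} {A B C : Matrix (Fin n) (Fin n) ℂ}
  {d : ν → ℝ} {α : Fin N → ℝ} {X : Matrix (Fin n) ν ℂ}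
  {Q : Matrix (Fin n) (Fin N) ℂ} {Z : Matrix ν ι ℂ} {U : Matrix ι (Fin N) ℂ}

theorem coordinates_gram (hX : Xᴴ * B * X = 1) (hQ : Q = X * Z * U) (hU : U * Uᴴ = 1)
    (hQB : Qᴴ * B * Q = 1) : Zᴴ * Z = 1 := by
  calc Zᴴ * Z = (U * Uᴴ) * (Zᴴ * (Xᴴ * B * X) * Z) * (U * Uᴴ) := by
        rw [hU, hX, Matrix.mul_one, Matrix.one_mul, Matrix.mul_one]
    _ = U * (Qᴴ * B * Q) * Uᴴ := by
        rw [hQ]; simp only [conjTranspose_mul, Matrix.mul_assoc]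
    _ = 1 := by rw [hQB, Matrix.mul_one, hU]

theorem coordinates_compression (hX : Xᴴ * B * X = 1) (hAX : A * X = B * X * rdiag d)
    (hQ : Q = X * Z * U) (hU : U * Uᴴ = 1) (hQA : Qᴴ * A * Q = rdiag α) :
    Zᴴ * rdiag d * Z = U * rdiag α * Uᴴ := by
  have h1 : Xᴴ * A * X = rdiag d := by
    rw [Matrix.mul_assoc, hAX, ← Matrix.mul_assoc, ← Matrix.mul_assoc, hX, Matrix.one_mul]
  calc Zᴴ * rdiag d * Z = (U * Uᴴ) * (Zᴴ * (Xᴴ * A * X) * Z) * (U * Uᴴ) := by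
        rw [hU, h1, Matrix.one_mul, Matrix.mul_one]
    _ = U * (Qᴴ * A * Q) * Uᴴ := by
        rw [hQ]; simp only [conjTranspose_mul, Matrix.mul_assoc]
    _ = _ := by rw [hQA]

/-- For `z = Z u` with `u` the column of `U`, the residual is `C* (C X) (diag(d) - t) z`, and `C X`
is an isometry. -/
theorem vnorm_residual_le_coordinates (hB : B = Cᴴ * C) (hX : Xᴴ * B * X = 1)
    (hAX : A * X = B * X * rdiag d) (hQ : Q = X * Z * U) (r : Fin N) (t : ℝ) :
    vnorm (A *ᵥ Q.col r - (t : ℂ) • (B *ᵥ Q.col r)) ≤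
      ‖C‖ * vnorm (rdiag (fun i => d i - t) *ᵥ (Z *ᵥ U.col r)) := by
  have hq : Q.col r = X *ᵥ (Z *ᵥ U.col r) := by
    rw [hQ, mulVec_mulVec]
    ext i
    simp [Matrix.mul_apply, mulVec, dotProduct]
  have hCX : (C * X)ᴴ * (C * X) = 1 := by
    rw [← hX, hB, conjTranspose_mul]
    simp only [Matrix.mul_assoc]
  set z := Z *ᵥ U.col r
  have : A *ᵥ Q.col r - (t : ℂ) • (B *ᵥ Q.col r) =
      Cᴴ *ᵥ ((C * X) *ᵥ (rdiag (fun i => d i - t) *ᵥ z)) := by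
    rw [hq, rdiag_sub_const_mulVec, mulVec_sub, mulVec_sub, mulVec_smul, mulVec_smul]
    simp only [mulVec_mulVec]
    rw [hAX, hB]
    simp only [Matrix.mul_assoc]
  rw [this]
  refine vnorm_mulVec_le_of_le (norm_conjTranspose_le le_rfl) ?_
  rw [vnorm_mulVec_isometry hCX]

end Coordinates

theorem fromCols_mul_fromBlocks_inv {ι κ ν o : Type*} [Fintype ι] [DecidableEq ι] [Fintype κ]
    [Fintype ν] (X₁ : Matrix o ι ℂ) (X₂ : Matrix o ν ℂ) (L : Matrix ι ι ℂ) (G : Matrix ν ι ℂ)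
    (S : Matrix ι κ ℂ) (T : Matrix ν κ ℂ) :
    fromCols X₁ X₂ * fromBlocks L⁻¹ S (G * L⁻¹) T =
      fromCols ((X₁ + X₂ * G) * L⁻¹) (X₁ * S + X₂ * T) := by
  rw [← fromCols_fromRows_eq_fromBlocks, mul_fromCols, fromCols_mul_fromRows, fromCols_mul_fromRows,
    Matrix.add_mul, Matrix.mul_assoc X₂]

section Extended

theorem ofReal_le_eigenvalue_bound {x ℓ ε t : ℝ} {c : ℝ≥0∞} (hℓ : 0 ≤ ℓ) (hε : 0 ≤ ε)
    (ht : 0 ≤ t) (hx : x ≤ 4 * ℓ * (ε ^ 2 + t)) (hc : ENNReal.ofReal t ≤ c) :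
    ENNReal.ofReal x ≤ 4 * ENNReal.ofReal ℓ * (ENNReal.ofReal ε ^ 2 + c) := by
  calc ENNReal.ofReal x ≤ ENNReal.ofReal (4 * ℓ * (ε ^ 2 + t)) := ENNReal.ofReal_le_ofReal hx
    _ = 4 * ENNReal.ofReal ℓ * (ENNReal.ofReal ε ^ 2 + ENNReal.ofReal t) := by
        rw [ENNReal.ofReal_mul (by positivity), ENNReal.ofReal_mul (by norm_num),
          ENNReal.ofReal_add (by positivity) ht, ENNReal.ofReal_pow hε, ENNReal.ofReal_ofNat]
    _ ≤ _ := by gcongr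

theorem ofReal_le_residual_bound {x K ℓ ε t : ℝ} {c : ℝ≥0∞} (hK : 0 ≤ K) (hℓ : 0 ≤ ℓ)
    (hε : 0 ≤ ε) (ht : 0 ≤ t) (hx : x ≤ K * (12 * ℓ * ε * (1 + t)))
    (hc : ENNReal.ofReal t ≤ c) :
    ENNReal.ofReal x ≤ 12 * ENNReal.ofReal K * ENNReal.ofReal ℓ * ENNReal.ofReal ε * (1 + c) := by
  calc ENNReal.ofReal x ≤ ENNReal.ofReal (12 * K * ℓ * ε * (1 + t)) :=
        ENNReal.ofReal_le_ofReal (hx.trans_eq (by ring))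
    _ = 12 * ENNReal.ofReal K * ENNReal.ofReal ℓ * ENNReal.ofReal ε * (1 + ENNReal.ofReal t) := by
        rw [ENNReal.ofReal_mul (by positivity), ENNReal.ofReal_mul (by positivity),
          ENNReal.ofReal_mul (by positivity), ENNReal.ofReal_mul (by norm_num),
          ENNReal.ofReal_add zero_le_one ht, ENNReal.ofReal_ofNat, ENNReal.ofReal_one]
    _ ≤ _ := by gcongr

/-- The quotient by a zero gap is `⊤` unless `ε = 0`, and then both entries of the minimum vanish.
-/
theorem ofReal_le_min_div_zero {ε : ℝ} :
    ENNReal.ofReal ε ≤ min (ENNReal.ofReal ε) (4 * ENNReal.ofReal ε ^ 2 / 0) := by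
  refine le_min le_rfl ?_
  rcases eq_or_ne (ENNReal.ofReal ε) 0 with h | h
  · simp [h]
  · rw [ENNReal.div_zero (mul_ne_zero (by norm_num) (pow_ne_zero _ h))]
    exact le_top

theorem ofReal_min_le {ε η : ℝ} (hε : 0 ≤ ε) (hη : 0 < η) :
    ENNReal.ofReal (min ε (4 * ε ^ 2 / η)) ≤
      min (ENNReal.ofReal ε) (4 * ENNReal.ofReal ε ^ 2 / ENNReal.ofReal η) := by
  refine le_min (ENNReal.ofReal_le_ofReal (min_le_left _ _)) ?_
  refine (ENNReal.ofReal_le_ofReal (min_le_right _ _)).trans_eq ?_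
  rw [ENNReal.ofReal_div_of_pos hη, ENNReal.ofReal_mul (by norm_num), ENNReal.ofReal_pow hε,
    ENNReal.ofReal_ofNat]

end Extended

/-- The gap is infinite, zero, or `δ / ‖Λ‖` for the distance `δ` of the two spectra. -/
theorem gap_cases {n m p : ℕ} (hmn : m ≤ n) (hmp : m < p) (hm : 0 < m) (lam : Fin n → ℝ)
    (H : Matrix (Fin (n - m)) (Fin (p - m)) ℂ) (hlam : 0 < ‖rdiag lam‖) (μ : Fin (p - m) → ℝ)
    (hμ : ∀ l, μ l ∈ spectrum ℝ (Hᴴ * rdiag (tailVals hmn lam) * H)) :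
    gap hmn lam H = 0 ∨ ∃ δ > 0, gap hmn lam H = ENNReal.ofReal (δ / ‖rdiag lam‖) ∧
      ∀ j l, δ ≤ |headVals hmn lam j - μ l| := by
  set g : ℝ≥0∞ := ⨅ i : Fin m, ⨅ μ ∈ spectrum ℝ (Hᴴ * rdiag (tailVals hmn lam) * H),
      ENNReal.ofReal |headVals hmn lam i - μ| with hg
  have hgap : gap hmn lam H = g / ‖rdiag lam‖ₑ := by rw [gap, if_pos hmp]
  have hle (j l) : g ≤ ENNReal.ofReal |headVals hmn lam j - μ l| :=
    (iInf_le _ j).trans (iInf₂_le (μ l) (hμ l))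
  have htop : g ≠ ⊤ :=
    ((hle ⟨0, hm⟩ ⟨0, by omega⟩).trans_lt ENNReal.ofReal_lt_top).ne
  rcases eq_or_ne g 0 with h0 | h0
  · left
    rw [hgap, h0, ENNReal.zero_div]
  · right
    refine ⟨g.toReal, ENNReal.toReal_pos h0 htop, ?_, fun j l => ?_⟩
    · rw [hgap, ENNReal.ofReal_div_of_pos hlam, ENNReal.ofReal_toReal htop, ofReal_norm]
    · exact ENNReal.toReal_le_of_le_ofReal (abs_nonneg _) (hle j l)

end SplitColumns

/-! ### Case distinction on the gap, and the theorem. -/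

section Assembly

open Matrix

/-- Eigenvalue and residual estimates for a basis in block coordinates. -/
theorem exists_ritz_estimates {n p m : ℕ} (hmp : m ≤ p) (hmn : m ≤ n) (lam : Fin n → ℝ)
    {G : Matrix (Fin (n - m)) (Fin m) ℂ} {L : Matrix (Fin m) (Fin m) ℂ}
    {S : Matrix (Fin m) (Fin (p - m)) ℂ} {H : Matrix (Fin (n - m)) (Fin (p - m)) ℂ}
    {R : Matrix (Fin (p - m)) (Fin (p - m)) ℂ} {U : Matrix (Fin m ⊕ Fin (p - m)) (Fin p) ℂ}
    {α : Fin p → ℝ} {K : ℝ} {res : Fin p → ℝ} (hL : Lᴴ * L = 1 + Gᴴ * G)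
    (hZ : (fromBlocks L⁻¹ S (G * L⁻¹) (H * R))ᴴ * fromBlocks L⁻¹ S (G * L⁻¹) (H * R) = 1)
    (hG : ‖G‖ ≤ 1 / 2) (hH : Hᴴ * H = 1) (hU : U * Uᴴ = 1) (hU' : Uᴴ * U = 1)
    (hN : (fromBlocks L⁻¹ S (G * L⁻¹) (H * R))ᴴ *
      rdiag (Sum.elim (headVals hmn lam) (tailVals hmn lam)) *
      fromBlocks L⁻¹ S (G * L⁻¹) (H * R) = U * rdiag α * Uᴴ) (hK : 0 ≤ K)
    (hres : ∀ r, res r ≤ K * vnorm (rdiag (fun i =>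
      Sum.elim (headVals hmn lam) (tailVals hmn lam) i - α r) *ᵥ
        (fromBlocks L⁻¹ S (G * L⁻¹) (H * R) *ᵥ U.col r))) :
    ∃ σ : Fin m ↪ Fin p, ∀ j : Fin m,
      ENNReal.ofReal |headVals hmn lam j - α (σ j)| ≤
        4 * ENNReal.ofReal ‖rdiag lam‖ * (ENNReal.ofReal ‖G‖ ^ 2 +
          min (ENNReal.ofReal ‖G‖) (4 * ENNReal.ofReal ‖G‖ ^ 2 / gap hmn lam H)) ∧
      (gap hmn lam H ≠ 0 → ENNReal.ofReal (res (σ j)) ≤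
        12 * ENNReal.ofReal K * ENNReal.ofReal ‖rdiag lam‖ * ENNReal.ofReal ‖G‖ *
          (1 + 1 / gap hmn lam H)) := by
  have ha : ‖rdiag (headVals hmn lam)‖ ≤ ‖rdiag lam‖ :=
    norm_rdiag_le (norm_nonneg _) fun i => abs_le_norm_rdiag lam _
  have hb : ‖rdiag (tailVals hmn lam)‖ ≤ ‖rdiag lam‖ :=
    norm_rdiag_le (norm_nonneg _) fun i => abs_le_norm_rdiag lam _
  obtain ⟨D, S', H', R', μ, W, hred, hZW, hW, hW', hμ⟩ :=
    exists_isReduced (headVals hmn lam) (tailVals hmn lam) ha hb hL hZ (by linarith) hH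
  have hZ2 : blockBasis D G S' H' R' = fromBlocks L⁻¹ S (G * L⁻¹) (H * R) * Wᴴ := by
    rw [hZW, Matrix.mul_assoc, hW', Matrix.mul_one]
  set Z₁ := fromBlocks L⁻¹ S (G * L⁻¹) (H * R)
  set Z := blockBasis D G S' H' R'
  set d := Sum.elim (headVals hmn lam) (tailVals hmn lam)
  set V := W * U with hV
  have hV1 : V * Vᴴ = 1 := by
    rw [hV, conjTranspose_mul, Matrix.mul_assoc, ← Matrix.mul_assoc U, hU, Matrix.one_mul, hW']
  have hV2 : Vᴴ * V = 1 := by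
    rw [hV, conjTranspose_mul, Matrix.mul_assoc, ← Matrix.mul_assoc Wᴴ, hW, Matrix.one_mul, hU']
  have hZZ : Zᴴ * Z = 1 := by
    rw [hZ2, conjTranspose_mul, conjTranspose_conjTranspose, Matrix.mul_assoc,
      ← Matrix.mul_assoc Z₁ᴴ, hZ, Matrix.one_mul, hW']
  have hNV : Zᴴ * rdiag d * Z = V * rdiag α * Vᴴ := by
    calc Zᴴ * rdiag d * Z = W * (Z₁ᴴ * rdiag d * Z₁) * Wᴴ := by
          rw [hZ2, conjTranspose_mul, conjTranspose_conjTranspose]; simp only [Matrix.mul_assoc]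
      _ = V * rdiag α * Vᴴ := by
          rw [hN, hV, conjTranspose_mul]; simp only [Matrix.mul_assoc]
  have hcol (r) : Z₁ *ᵥ U.col r = Z *ᵥ V.col r := by
    have : V.col r = W *ᵥ U.col r := by
      ext i
      simp [hV, Matrix.mul_apply, mulVec, dotProduct]
    rw [this, mulVec_mulVec, ← hZW]
  have hcard : Fintype.card (Fin m ⊕ Fin (p - m)) = p := by
    simp only [Fintype.card_sum, Fintype.card_fin]; omega
  simp only [hcol] at hres
  obtain ⟨hε, hℓ⟩ := hred.nonneg
  rcases Nat.eq_zero_or_pos m with hm | hm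
  · subst hm
    exact ⟨Fin.castLEEmb hmp, fun j => j.elim0⟩
  rcases hmp.eq_or_lt with heq | hlt
  · have hempty : IsEmpty (Fin (p - m)) := by
      rw [heq, Nat.sub_self]; infer_instance
    have htop : gap hmn lam H = ⊤ := by rw [gap, if_neg (by omega)]
    obtain ⟨σ, hσ⟩ := hred.exists_matching_of_isEmpty hcard hV1 hV2 hNV hZZ hG
    refine ⟨σ, fun j => ⟨?_, fun _ => ?_⟩⟩
    · refine ofReal_le_eigenvalue_bound hℓ hε le_rfl ?_ (by simp)
      refine (hσ j).1.trans ?_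
      have : 0 ≤ ‖rdiag lam‖ * ‖G‖ ^ 2 := by positivity
      linarith
    · refine ofReal_le_residual_bound hK hℓ hε le_rfl ?_ (by simp)
      refine (hres _).trans (mul_le_mul_of_nonneg_left ?_ hK)
      simpa using (hσ j).2
  -- If `Λ = 0`, the gap involves a division by zero, but all Ritz values and residuals vanish and
  -- any embedding will do.
  rcases hℓ.eq_or_lt with hℓ0 | hℓ0
  · refine ⟨Fin.castLEEmb hmp, fun j => ⟨?_, fun _ => ?_⟩⟩
    · refine ofReal_le_eigenvalue_bound (t := 0) hℓ hε le_rfl ?_ (by simp)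
      have h1 := hred.abs_ritzValue_le hV2 hNV hZZ (Fin.castLEEmb hmp j)
      have h2 := (abs_le_norm_rdiag (headVals hmn lam) j).trans ha
      have := abs_sub (headVals hmn lam j) (α (Fin.castLEEmb hmp j))
      rw [← hℓ0] at h1 h2 ⊢
      linarith
    · refine ofReal_le_residual_bound (t := 0) hK hℓ hε le_rfl ?_ (by simp)
      refine (hres _).trans (mul_le_mul_of_nonneg_left ?_ hK)
      refine (hred.vnorm_residual_le_two_mul hZZ (hred.abs_ritzValue_le hV2 hNV hZZ _)
        (IsReduced.vnorm_col hV2 _).le).trans ?_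
      rw [← hℓ0]
      simp
  rcases gap_cases hmn hlt hm lam H hℓ0 μ hμ with h0 | ⟨δ, hδ, hgap, hsep⟩
  · obtain ⟨σ, hσ⟩ := hred.exists_matching_of_no_gap hcard hV1 hNV
    refine ⟨σ, fun j => ⟨?_, fun h => absurd h0 h⟩⟩
    rw [h0]
    refine ofReal_le_eigenvalue_bound hℓ hε hε ((hσ j).trans ?_) ofReal_le_min_div_zero
    have h1 : 0 ≤ ‖rdiag lam‖ * ‖G‖ ^ 2 := by positivity
    have h2 : 0 ≤ ‖rdiag lam‖ * ‖G‖ := by positivity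
    linarith
  · obtain ⟨σ, hσ⟩ := hred.exists_matching_of_gap hcard hV1 hV2 hNV hZZ hδ hsep
    have hη : 0 < δ / ‖rdiag lam‖ := div_pos hδ hℓ0
    refine ⟨σ, fun j => ⟨?_, fun _ => ?_⟩⟩
    · rw [hgap]
      refine ofReal_le_eigenvalue_bound hℓ hε (le_min hε (by positivity)) ?_
        (ofReal_min_le hε hη)
      refine (hσ j).1.trans ?_
      have h1 : 0 ≤ ‖rdiag lam‖ * ‖G‖ ^ 2 := by positivity
      have h2 : 0 ≤ ‖rdiag lam‖ * ‖G‖ := by positivity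
      have h3 : 4 * ‖G‖ ^ 2 * ‖rdiag lam‖ ^ 2 / δ =
          ‖rdiag lam‖ * (4 * ‖G‖ ^ 2 / (δ / ‖rdiag lam‖)) := by field_simp
      have h4 : 0 ≤ 4 * ‖G‖ ^ 2 * ‖rdiag lam‖ ^ 2 / δ := by positivity
      have h5 := min_le_left (2 * ‖G‖ * ‖rdiag lam‖) (4 * ‖G‖ ^ 2 * ‖rdiag lam‖ ^ 2 / δ)
      have h6 := min_le_right (2 * ‖G‖ * ‖rdiag lam‖) (4 * ‖G‖ ^ 2 * ‖rdiag lam‖ ^ 2 / δ)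
      rcases min_choice ‖G‖ (4 * ‖G‖ ^ 2 / (δ / ‖rdiag lam‖)) with hc | hc <;> rw [hc]
      · linarith
      · linarith
    · rw [hgap]
      refine ofReal_le_residual_bound (t := ‖rdiag lam‖ / δ) hK hℓ hε (by positivity)
        ((hres _).trans (mul_le_mul_of_nonneg_left (hσ j).2 hK)) ?_
      rw [← ENNReal.ofReal_one, ← ENNReal.ofReal_div_of_pos hη, one_div_div]

end Assembly

end Feast

end

theorem mainTheorem5 {n p m : ℕ} (hmp : m ≤ p) (hpn : p ≤ n)
    (A B C X : Matrix (Fin n) (Fin n) ℂ) (lam : Fin n → ℝ)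
    (hA : A.IsHermitian) (hC : IsUnit C) (hB : B = Cᴴ * C)
    (hX : Xᴴ * B * X = 1) (hAX : A * X = B * X * Feast.rdiag lam)
    (ρ : ℝ → ℝ) (Q Δ Y : ℕ → Matrix (Fin n) (Fin p) ℂ)
    (Xhat : ℕ → Matrix (Fin p) (Fin p) ℂ) (lamhat : ℕ → Fin p → ℝ)
    (hrun : Feast.IsRun A B (Feast.accel B X lam ρ) Q Δ Y Xhat lamhat)
    (k : ℕ) (hk : 1 ≤ k)
    (G : Matrix (Fin (n - m)) (Fin m) ℂ) (L : Matrix (Fin m) (Fin m) ℂ)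
    (V : Matrix (Fin n) (Fin (p - m)) ℂ) (U : Matrix (Fin p) (Fin p) ℂ)
    (hL : Lᴴ * L =
      (Feast.headCols (hmp.trans hpn) X + Feast.tailCols (hmp.trans hpn) X * G)ᴴ * B *
        (Feast.headCols (hmp.trans hpn) X + Feast.tailCols (hmp.trans hpn) X * G))
    (hU : U ∈ Matrix.unitaryGroup (Fin p) ℂ)
    (hQ : Q k = Feast.hcat hmp
      ((Feast.headCols (hmp.trans hpn) X + Feast.tailCols (hmp.trans hpn) X * G) * L⁻¹) V * U)
    (hG : ‖G‖ ≤ 1 / 2) :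
    (∃ (S : Matrix (Fin m) (Fin (p - m)) ℂ) (H : Matrix (Fin (n - m)) (Fin (p - m)) ℂ)
      (R : Matrix (Fin (p - m)) (Fin (p - m)) ℂ),
      V = Feast.headCols (hmp.trans hpn) X * S + Feast.tailCols (hmp.trans hpn) X * H * R ∧
      Hᴴ * H = 1 ∧ ‖S‖ ≤ ‖G‖ ∧ ‖R - 1‖ ≤ ‖G‖ ^ 2) ∧
    ∀ (S : Matrix (Fin m) (Fin (p - m)) ℂ) (H : Matrix (Fin (n - m)) (Fin (p - m)) ℂ)
      (R : Matrix (Fin (p - m)) (Fin (p - m)) ℂ),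
      V = Feast.headCols (hmp.trans hpn) X * S + Feast.tailCols (hmp.trans hpn) X * H * R →
      Hᴴ * H = 1 →
      ∃ σ : Fin m ↪ Fin p, ∀ j : Fin m,
        ENNReal.ofReal |Feast.headVals (hmp.trans hpn) lam j - lamhat k (σ j)| ≤
            4 * ‖Feast.rdiag lam‖ₑ *
              (‖G‖ₑ ^ 2 +
                min ‖G‖ₑ (4 * ‖G‖ₑ ^ 2 / Feast.gap (hmp.trans hpn) lam H)) ∧
        (Feast.gap (hmp.trans hpn) lam H ≠ 0 →
          ‖WithLp.toLp 2 (A *ᵥ (Q k).col (σ j) -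
              (lamhat k (σ j) : ℂ) • (B *ᵥ (Q k).col (σ j)))‖ₑ ≤
            12 * ‖C‖ₑ * ‖Feast.rdiag lam‖ₑ * ‖G‖ₑ *
              (1 + 1 / Feast.gap (hmp.trans hpn) lam H)) := by
  obtain ⟨k, rfl⟩ : ∃ k', k = k' + 1 := ⟨k - 1, by omega⟩
  have hit := hrun k
  have hQA := hit.compression_eq
  have hQB := hit.orthonormal
  set hmn := hmp.trans hpn
  set Xb := X.submatrix id (Feast.split hmn) with hXb
  have hcols : Matrix.fromCols (Feast.headCols hmn X) (Feast.tailCols hmn X) = Xb :=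
    Feast.fromCols_headCols_tailCols hmn X
  have hXB : Xbᴴ * B * Xb = 1 := by
    have : Xbᴴ * B * Xb = (Xᴴ * B * X).submatrix (Feast.split hmn) (Feast.split hmn) := rfl
    rw [this, hX, Matrix.submatrix_one_equiv]
  have hXA : A * Xb = B * Xb *
      Feast.rdiag (Sum.elim (Feast.headVals hmn lam) (Feast.tailVals hmn lam)) := by
    have h1 : A * Xb = (A * X).submatrix id (Feast.split hmn) := rfl
    rw [h1, hAX, Feast.sumElim_headVals_tailVals]
    ext i j
    simp only [Matrix.submatrix_apply, Feast.rdiag, Matrix.mul_diagonal]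
    rfl
  have hXinv : Xb * (Xbᴴ * B) = 1 := by
    have h1 : X * (Xᴴ * B) = 1 := mul_eq_one_comm.1 hX
    have h2 : Xb * (Xbᴴ * B) = X * (Xᴴ * B) := by
      rw [hXb, Matrix.conjTranspose_submatrix]
      have : Xᴴ.submatrix (Feast.split hmn) id * B =
        (Xᴴ * B).submatrix (Feast.split hmn) id := rfl
      rw [this, Matrix.submatrix_mul_equiv, Matrix.submatrix_id_id]
    rw [h2, h1]
  obtain ⟨hU', hU⟩ := Feast.submatrix_split_unitary hmp hU
  set Us := U.submatrix (Feast.split hmp) id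
  have hQZ {S : Matrix (Fin m) (Fin (p - m)) ℂ} {T : Matrix (Fin (n - m)) (Fin (p - m)) ℂ}
      (hV : V = Feast.headCols hmn X * S + Feast.tailCols hmn X * T) :
      Q (k + 1) = Xb * Matrix.fromBlocks L⁻¹ S (G * L⁻¹) T * Us := by
    rw [hQ, Feast.hcat_mul, ← hcols, Feast.fromCols_mul_fromBlocks_inv, ← hV]
  have hLG : Lᴴ * L = 1 + Gᴴ * G := by
    have h1 : Feast.headCols hmn X + Feast.tailCols hmn X * G =
        Xb * Matrix.fromRows (1 : Matrix (Fin m) (Fin m) ℂ) G := by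
      rw [← hcols, Matrix.fromCols_mul_fromRows, Matrix.mul_one]
    rw [hL, h1, Matrix.conjTranspose_mul]
    calc _ = (Matrix.fromRows (1 : Matrix (Fin m) (Fin m) ℂ) G)ᴴ * (Xbᴴ * B * Xb) *
          Matrix.fromRows (1 : Matrix (Fin m) (Fin m) ℂ) G := by
          simp only [Matrix.mul_assoc]
      _ = 1 + Gᴴ * G := by
          rw [hXB, Matrix.mul_one, Matrix.conjTranspose_fromRows_eq_fromCols_conjTranspose,
            Matrix.fromCols_mul_fromRows, Matrix.conjTranspose_one, Matrix.one_mul]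
  obtain ⟨D, hD, hD1, -, -⟩ := Feast.exists_inv_sqrt_one_add_gram G
  obtain ⟨-, -, hLL, -⟩ := Feast.inv_factor_eq hLG hD hD1
  constructor
  -- As `Xb* B` inverts `Xb`, the coordinates of `V` are the two row blocks of `Xb* B V`.
  · obtain ⟨S, T, hST⟩ : ∃ (S : Matrix (Fin m) (Fin (p - m)) ℂ)
        (T : Matrix (Fin (n - m)) (Fin (p - m)) ℂ), Xbᴴ * B * V = Matrix.fromRows S T :=
      ⟨_, _, (Matrix.fromRows_toRows _).symm⟩
    have hV : V = Feast.headCols hmn X * S + Feast.tailCols hmn X * T := by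
      rw [← Matrix.fromCols_mul_fromRows, hcols, ← hST, ← Matrix.mul_assoc, hXinv, Matrix.one_mul]
    have hZ := Feast.coordinates_gram hXB (hQZ hV) hU hQB
    obtain ⟨H, R, hT, hH, hR⟩ := Feast.exists_polar_factorization hLL hZ (by linarith)
    refine ⟨S, H, R, ?_, hH, Feast.norm_coupling_le hLL hZ, hR⟩
    rw [hV, hT, Matrix.mul_assoc]
  · intro S H R hV hH
    rw [Matrix.mul_assoc] at hV
    have hQ' := hQZ hV
    obtain ⟨σ, hσ⟩ := Feast.exists_ritz_estimates hmp hmn lam hLG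
      (Feast.coordinates_gram hXB hQ' hU hQB) hG hH hU hU'
      (Feast.coordinates_compression hXB hXA hQ' hU hQA) (norm_nonneg C)
      fun r => Feast.vnorm_residual_le_coordinates hB hXB hXA hQ' r (lamhat (k + 1) r)
    refine ⟨σ, fun j => ?_⟩
    simp only [← ofReal_norm]
    exact hσ j
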